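/- **Definitions.** Smooth means $C^\infty$. For a distribution $\mathcal D$ (a smooth field of tangent planes), the derived flag is $\mathcal D^{(0)}=\mathcal D$, $\mathcal D^{(i+1)}=\mathcal D^{(i)}+[\mathcal D^{(i)},\mathcal D^{(i)}]$. A *Goursat structure* on a manifold of dimension $n\ge 3$ is a rank two distribution $\mathcal D$ with $\dim\mathcal D^{(i)}(q)=i+2$ for all points $q$ and $0\le i\le n-2$. Let $\mathcal C_i$ denote the characteristic distribution of $\mathcal D^{(i+1)}$, i.e. the one spanned by the vector fields $f\in\mathcal D^{(i+1)}$ with $[f,\mathcal D^{(i+1)}]\subset\mathcal D^{(i+1)}$. Put $S^{(i)}_0=\{q:\mathcal D^{(i)}(q)=\mathcal C_{i+1}(q)\}$ for $0\le i\le n-5$, $S^{(i)}_j=\{q\in S^{(i)}_{j-1}:\mathcal D^{(i-j)}(q)\cap T_qS^{(i)}_{j-1}\ne\mathcal C_{i-j}(q)\}$ for $1\le j\le i$, and $S^{(i)}_j=\emptyset$ otherwise. The *singularity type* $\delta_{\mathcal D}(p)=w_0\cdots w_{n-4}$ is the word in which $w_{n-4-i}=a_{j+1}$ if $p\in S^{(i+j)}_j$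 for some $j\ge0$, and $w_{n-4-i}=a_0$ if there is no such $j$. *Kumpera–Ruiz normal forms* are the pairs $\kappa^n=(\kappa^n_1,\kappa^n_2)$ of vector fields on $\mathbb R^n$ obtained from $\kappa^3=(\partial_{x_3},\,x_3\partial_{x_2}+\partial_{x_1})$ by successive prolongations $\kappa^{i-1}\mapsto\kappa^i$, where $\kappa_1^i=\partial_{x_i}$ and either $\kappa_2^i=(x_i+c_i)\kappa_1^{i-1}+\kappa_2^{i-1}$ with $c_i\in\mathbb R$ (regular) or $\kappa_2^i=\kappa_1^{i-1}+x_i\kappa_2^{i-1}$ (singular). For $n\ge4$ the first prolongation is assumed to be regular with $c_4=0$. A *(generalized) contact transformation* between two distributions is a smooth diffeomorphism that maps one onto the other. **Theorem.** Let $\phi$ be a local contact transformation, with $\phi(p)=\tilde p$, between Goursat structures $\mathcal D$ and $\tilde{\mathcal D}$ on $n$-manifolds, $n\geq 3$. Let $x$ and $\tilde x$ be local coordinates centered at $p$ and $\tilde p$ that transform $\mathcal D$ and $\tilde{\mathcal D}$ into (the distributions spanned by) Kumpera–Ruiz normal forms $\kappa^n$ and $\tilde\kappa^n$, with constants $c_i$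 and $\tilde c_i$, and let $\Phi=\tilde x\circ\phi\circ x^{-1}$. Then $\delta_{\mathcal D}(p)=\delta_{\tilde{\mathcal D}}(\tilde p)=:w_0\cdots w_{n-4}$, and for arbitrarily small open neighborhoods $W$ of $0$ the maps $\Phi^{(i)}=(\Phi_1,\dots,\Phi_i)$, $3\le i\le n$, depend on $(x_1,\dots,x_i)$ only and are smooth diffeomorphisms between the projections to $\mathbb R^i$ of $W$ and of $\Phi(W)$. On every open neighborhood $W$ of $0$ with this property the following holds. 1. $\Phi^{(3)}$ is a contact transformation between $\kappa^3$ and $\tilde\kappa^3$. There are smooth functions $\nu_3,\eta_3,\mu_3,\lambda_3$ of $(x_1,x_2,x_3)$, uniquely determined by $\Phi^{(3)}$, and, for $4\le i\le n$, smooth functions $\nu_i,\eta_i,\mu_i$ of $(x_1,\dots,x_i)$, uniquely determined by $\Phi^{(i)}$, such that, with $\Psi^{(i)}=(\Phi^{(i)})^{-1}$, $$\Phi^{(3)}_*\kappa^3_1=(\nu_3\circ\Psi^{(3)})\tilde\kappa^3_1+(\lambda_3\circ\Psi^{(3)})\tilde\kappa^3_2,\qquad \Phi^{(3)}_*\kappa^3_2=(\eta_3\circ\Psi^{(3)})\tilde\kappa^3_1+(\mu_3\circ\Psi^{(3)})\tilde\kappa^3_2,$$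 $$\Phi^{(i)}_*\kappa^i_1=(\nu_i\circ\Psi^{(i)})\tilde\kappa^i_1,\qquad \Phi^{(i)}_*\kappa^i_2=(\eta_i\circ\Psi^{(i)})\tilde\kappa^i_1+(\mu_i\circ\Psi^{(i)})\tilde\kappa^i_2\qquad(4\le i\le n).$$ 2. If $n\ge4$ then $$\Phi_4=\frac{\eta_3+x_4\nu_3}{\mu_3+x_4\lambda_3},\quad \mu_4=\mu_3+x_4\lambda_3,\quad \nu_4=\mathrm L_{\kappa^4_1}\Phi_4=\frac{\mu_3\nu_3-\lambda_3\eta_3}{(\mu_3+x_4\lambda_3)^2},\quad \eta_4=\mathrm L_{\kappa_2^4}\Phi_4.$$ 3. If $5\le i\le n$ and $w_{i-4}\ne a_1$ then the $i$-th prolongation steps $\kappa^{i-1}\mapsto\kappa^i$ and $\tilde\kappa^{i-1}\mapsto\tilde\kappa^i$ are both regular, and $$\tilde c_i=c_i\frac{\nu_{i-1}(0)}{\mu_{i-1}(0)}+\frac{\eta_{i-1}(0)}{\mu_{i-1}(0)},\qquad \Phi_i=\frac1{\mu_{i-1}}\bigl((x_i+c_i)\nu_{i-1}+\eta_{i-1}\bigr)-\tilde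 c_i,$$ $$\mu_i=\mu_{i-1},\qquad \nu_i=\mathrm L_{\kappa_1^i}\Phi_i=\nu_{i-1}/\mu_{i-1},\qquad \eta_i=\mathrm L_{\kappa_2^i}\Phi_i.$$ 4. If $5\le i\le n$ and $w_{i-4}=a_1$ then both steps are singular, and $$\Phi_i=\frac{x_i\mu_{i-1}}{\nu_{i-1}+x_i\eta_{i-1}},\quad \mu_i=\nu_{i-1}+x_i\eta_{i-1},\quad \nu_i=\mathrm L_{\kappa_1^i}\Phi_i=\frac{\mu_{i-1}\nu_{i-1}}{(\nu_{i-1}+x_i\eta_{i-1})^2},\quad \eta_i=\mathrm L_{\kappa_2^i}\Phi_i.$$ All denominators above are nowhere zero. Consequently $\Phi$ is uniquely determined by $\Phi^{(3)}$: if $\Phi'$ is a local contact transformation at $0$, $\Phi'(0)=0$, between $\kappa^n$ and a Kumpera–Ruiz normal form $\kappa'^n$ (with first prolongation regular with constant $0$ if $n\ge4$), and the first three components of $\Phi'$ and $\Phi$ agree near $0$, then $\kappa'^n=\tilde\kappa^n$ and $\Phi'=\Phi$ near $0$. -/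

import Mathlib

open Set Filter Topology
open scoped Manifold ContDiff

noncomputable section

namespace Goursat

/-! ### Distributions on manifolds -/

/-- The model space `ℝⁿ`; the coordinate `x_k` is the entry of index `k - 1`. -/
abbrev E (n : ℕ) : Type := EuclideanSpace ℝ (Fin n)

section Manifold

variable {n : ℕ} {M : Type*} [TopologicalSpace M] [ChartedSpace (E n) M]
  {M' : Type*} [TopologicalSpace M'] [ChartedSpace (E n) M']

variable (n M) in
/-- A field of linear subspaces of the tangent spaces of the `n`-manifold `M`. -/
abbrev Distribution : Type _ := ∀ q : M, Submodule ℝ (TangentSpace (𝓡 n) q)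

variable (n M) in
/-- A (not necessarily continuous) vector field on `M`. -/
abbrev VField : Type _ := ∀ q : M, TangentSpace (𝓡 n) q

section Smooth

variable [IsManifold (𝓡 n) ∞ M]

/-- The vector field `f` is smooth on the set `U`. -/
def SmoothOn (f : VField n M) (U : Set M) : Prop :=
  ContMDiffOn (𝓡 n) (𝓡 n).tangent ∞ (fun q => (⟨q, f q⟩ : TangentBundle (𝓡 n) M)) U

/-- `D` is a smooth distribution of rank `k`: it is locally spanned by `k` pointwise linearly
independent smooth vector fields. -/
def IsSmoothOfRank (D : Distribution n M) (k : ℕ) : Prop :=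
  ∀ p : M, ∃ U : Set M, IsOpen U ∧ p ∈ U ∧ ∃ f : Fin k → VField n M,
    (∀ j, SmoothOn (f j) U) ∧
    ∀ q ∈ U, LinearIndependent ℝ (fun j => f j q) ∧
      D q = Submodule.span ℝ (Set.range fun j => f j q)

/-- `f` restricts to a smooth section of `D` over `U`. -/
def IsSectionOn (D : Distribution n M) (f : VField n M) (U : Set M) : Prop :=
  SmoothOn f U ∧ ∀ q ∈ U, f q ∈ D q

/-- `D + [D, D]`. -/
def derived (D : Distribution n M) : Distribution n M := fun p =>
  D p ⊔ Submodule.span ℝ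
    {v | ∃ U : Set M, IsOpen U ∧ p ∈ U ∧ ∃ f g : VField n M,
      IsSectionOn D f U ∧ IsSectionOn D g U ∧ v = VectorField.mlieBracket (𝓡 n) f g p}

/-- The derived flag `D⁽⁰⁾ = D`, `D⁽ⁱ⁺¹⁾ = D⁽ⁱ⁾ + [D⁽ⁱ⁾, D⁽ⁱ⁾]`. -/
def derivedFlag (D : Distribution n M) : ℕ → Distribution n M
  | 0 => D
  | i + 1 => derived (derivedFlag D i)

/-- A Goursat structure on the `n`-manifold `M`, `n ≥ 3`. -/
structure IsGoursat (D : Distribution n M) : Prop where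
  three_le : 3 ≤ n
  smooth : IsSmoothOfRank D 2
  finrank_derivedFlag : ∀ i, i ≤ n - 2 → ∀ p : M, Module.finrank ℝ (derivedFlag D i p) = i + 2

/-- `f` is a characteristic vector field of `D` over `U`: a section of `D` with `[f, D] ⊆ D`. -/
def IsCharacteristicOn (D : Distribution n M) (f : VField n M) (U : Set M) : Prop :=
  IsSectionOn D f U ∧ ∀ V : Set M, IsOpen V → V ⊆ U → ∀ g : VField n M, IsSectionOn D g V →
    ∀ q ∈ V, VectorField.mlieBracket (𝓡 n) f g q ∈ D q

/-- The characteristic distribution of `D`. -/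
def characteristic (D : Distribution n M) : Distribution n M := fun p =>
  Submodule.span ℝ {v | ∃ U : Set M, IsOpen U ∧ p ∈ U ∧ ∃ f : VField n M,
    IsCharacteristicOn D f U ∧ v = f p}

/-- The distribution `C_i`: the characteristic distribution of `D⁽ⁱ⁺¹⁾`. -/
def cartanC (D : Distribution n M) (i : ℕ) : Distribution n M :=
  characteristic (derivedFlag D (i + 1))

/-! ### The singularity type -/

/-- The vectors tangent at `p` to the subset `S`: velocities at `p` of the smooth curves that
lie in `S`. For a submanifold `S` through `p` this is `T_p S`. -/
def tangentSet (S : Set M) (p : M) : Set (TangentSpace (𝓡 n) p) :=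
  {v | ∃ γ : ℝ → M, γ 0 = p ∧ ContMDiffAt 𝓘(ℝ, ℝ) (𝓡 n) ∞ γ 0 ∧ (∀ᶠ t in 𝓝 (0 : ℝ), γ t ∈ S) ∧
    mfderiv 𝓘(ℝ, ℝ) (𝓡 n) γ 0 (1 : ℝ) = v}

/-- `singularSet D i j` is the canonical submanifold `S_j⁽ⁱ⁾`: it starts with
`S_0⁽ⁱ⁾ = {p | D⁽ⁱ⁾(p) = C_{i+1}(p)}` for `0 ≤ i ≤ n - 5` and goes on with
`S_j⁽ⁱ⁾ = {p ∈ S_{j-1}⁽ⁱ⁾ | D⁽ⁱ⁻ʲ⁾(p) ∩ T_p S_{j-1}⁽ⁱ⁾ ≠ C_{i-j}(p)}` for `1 ≤ j ≤ i`; it is empty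
for all other indices. -/
def singularSet (D : Distribution n M) (i : ℕ) : ℕ → Set M
  | 0 => {p | i + 5 ≤ n ∧ derivedFlag D i p = cartanC D (i + 1) p}
  | j + 1 => {p | j + 1 ≤ i ∧ p ∈ singularSet D i j ∧
      (derivedFlag D (i - (j + 1)) p : Set (TangentSpace (𝓡 n) p)) ∩
          tangentSet (singularSet D i j) p ≠
        (cartanC D (i - (j + 1)) p : Set (TangentSpace (𝓡 n) p))}

open Classical in
/-- The index of the `i`-th letter: `j + 1` if `p ∈ S_j⁽ⁱ⁺ʲ⁾` for some `j` (there is at most one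
such `j` for a Goursat structure), and `0` otherwise. -/
def singularityLetter (D : Distribution n M) (p : M) (i : ℕ) : ℕ :=
  if h : ∃ j, p ∈ singularSet D (i + j) j then Nat.find h + 1 else 0

/-- The singularity type of `D` at `p`, a word of length `n - 3` in the letters `a_0, a_1, …`,
where the number `k` stands for the letter `a_k`. It is read from left to right, from the letter
of index `n - 4` above to the letter of index `0`. -/
def singularityType (D : Distribution n M) (p : M) : List ℕ :=
  (List.range (n - 3)).map fun k => singularityLetter D p (n - 4 - k)

end Smooth

/-! ### Contact transformations -/

/-- `φ` is a (generalized) contact transformation, from its source to its target, between the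
distributions `D` and `D'`: a smooth diffeomorphism with `φ_* D = D'`. -/
structure IsContact (D : Distribution n M) (D' : Distribution n M')
    (φ : OpenPartialHomeomorph M M') : Prop where
  smooth : ContMDiffOn (𝓡 n) (𝓡 n) ∞ φ φ.source
  smooth_symm : ContMDiffOn (𝓡 n) (𝓡 n) ∞ φ.symm φ.target
  map_eq : ∀ q ∈ φ.source,
    (D q).map (mfderiv (𝓡 n) (𝓡 n) φ q).toLinearMap = D' (φ q)

end Manifold

/-! ### Kumpera-Ruiz normal forms -/

/-- A prolongation: the singular one `S`, or the regular one `R_c` with parameter `c`. -/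
inductive Prolongation : Type
  | singular : Prolongation
  | regular (c : ℝ) : Prolongation

/-- The projection `(x_1, …, x_n) ↦ (x_1, …, x_i)`. -/
def proj {i n : ℕ} (h : i ≤ n) (x : E n) : E i :=
  WithLp.toLp 2 fun j => x (Fin.castLE h j)

/-- The inclusion `(v_1, …, v_n) ↦ (v_1, …, v_n, 0)`. -/
def incl {n : ℕ} (v : E n) : E (n + 1) :=
  WithLp.toLp 2 (Fin.snoc (α := fun _ => ℝ) (fun j => v j) 0)

/-- The lift to `ℝⁿ⁺¹` of a vector field on `ℝⁿ`. -/
def lift {n : ℕ} (f : E n → E n) (x : E (n + 1)) : E (n + 1) :=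
  incl (f (proj (Nat.le_succ n) x))

/-- The vector field `κ_1ⁱ = ∂/∂x_i` on `ℝⁱ`. -/
def kr₁ : (i : ℕ) → E i → E i
  | 0 => 0
  | i + 1 => fun _ => EuclideanSpace.single (Fin.last i) 1

/-- The vector field `κ_2ⁱ` on `ℝⁱ`, for `i ≥ 3`, of the Kumpera-Ruiz normal form defined by the
sequence of prolongations `σ 4, …, σ i` (so `κⁱ` is obtained from `κⁱ⁻¹` by `σ i`), starting from
`κ_2³ = x_3 ∂/∂x_2 + ∂/∂x_1`. The values for `i < 3` are irrelevant. -/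
def kr₂ (σ : ℕ → Prolongation) : (i : ℕ) → E i → E i
  | 0 => 0
  | 1 => 0
  | 2 => 0
  | 3 => fun x => !₂[1, x 2, 0]
  | i + 4 => fun x =>
    match σ (i + 4) with
    | Prolongation.regular c =>
        (x (Fin.last (i + 3)) + c) • lift (kr₁ (i + 3)) x + lift (kr₂ σ (i + 3)) x
    | Prolongation.singular =>
        lift (kr₁ (i + 3)) x + x (Fin.last (i + 3)) • lift (kr₂ σ (i + 3)) x

/-- The distribution on `ℝⁱ` spanned by the Kumpera-Ruiz normal form `κⁱ = (κ_1ⁱ, κ_2ⁱ)`. -/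
def krDist (σ : ℕ → Prolongation) (i : ℕ) : Distribution i (E i) := fun x =>
  Submodule.span ℝ ({kr₁ i x, kr₂ σ i x} : Set (E i))

/-- `x` is a system of local coordinates, defined near `p` and centered at `p`, that transforms
`D` into the distribution spanned by the Kumpera-Ruiz normal form `κⁿ` given by `σ`. -/
structure IsKRChart {n : ℕ} {M : Type*} [TopologicalSpace M] [ChartedSpace (E n) M]
    (D : Distribution n M) (p : M) (σ : ℕ → Prolongation)
    (x : OpenPartialHomeomorph M (E n)) : Prop where
  mem_source : p ∈ x.source
  centered : x p = 0
  isContact : IsContact D (krDist σ n) x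

/-! ### The components of a contact transformation -/

/-- The maps `Φs i`, for `3 ≤ i ≤ n`, are the diffeomorphisms `Φ⁽ⁱ⁾ = (Φ_1, …, Φ_i)`, viewed as
functions of `(x_1, …, x_i)`, between the projections to `ℝⁱ` of the open set `W` and of its
image `Φ(W)`. -/
structure IsTower {n : ℕ} (Φ : OpenPartialHomeomorph (E n) (E n)) (W : Set (E n))
    (Φs : ∀ i, OpenPartialHomeomorph (E i) (E i)) : Prop where
  source_eq : ∀ i, 3 ≤ i → ∀ hi : i ≤ n, (Φs i).source = proj hi '' W
  target_eq : ∀ i, 3 ≤ i → ∀ hi : i ≤ n, (Φs i).target = proj hi '' (Φ '' W)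
  smooth : ∀ i, 3 ≤ i → i ≤ n → ContDiffOn ℝ ∞ (Φs i) (Φs i).source
  smooth_symm : ∀ i, 3 ≤ i → i ≤ n → ContDiffOn ℝ ∞ (Φs i).symm (Φs i).target
  comm : ∀ i, 3 ≤ i → ∀ hi : i ≤ n, ∀ x ∈ W, Φs i (proj hi x) = proj hi (Φ x)

/-- The relations `Φ⁽³⁾_* κ_1³ = (ν ∘ Ψ⁽³⁾) κ̃_1³ + (lam ∘ Ψ⁽³⁾) κ̃_2³` and
`Φ⁽³⁾_* κ_2³ = (η ∘ Ψ⁽³⁾) κ̃_1³ + (μ ∘ Ψ⁽³⁾) κ̃_2³`, where `Ψ⁽³⁾` is the inverse of `Φ⁽³⁾`,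
with smooth functions `ν`, `η`, `μ`, `lam`. -/
structure FirstMultipliers (σ τ : ℕ → Prolongation) (Φ₃ : OpenPartialHomeomorph (E 3) (E 3))
    (ν η μ lam : E 3 → ℝ) : Prop where
  smooth_ν : ContDiffOn ℝ ∞ ν Φ₃.source
  smooth_η : ContDiffOn ℝ ∞ η Φ₃.source
  smooth_μ : ContDiffOn ℝ ∞ μ Φ₃.source
  smooth_lam : ContDiffOn ℝ ∞ lam Φ₃.source
  push₁ : ∀ x ∈ Φ₃.source, fderiv ℝ Φ₃ x (kr₁ 3 x) =
    ν x • kr₁ 3 (Φ₃ x) + lam x • kr₂ τ 3 (Φ₃ x)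
  push₂ : ∀ x ∈ Φ₃.source, fderiv ℝ Φ₃ x (kr₂ σ 3 x) =
    η x • kr₁ 3 (Φ₃ x) + μ x • kr₂ τ 3 (Φ₃ x)

/-- The relations `Φ⁽ⁱ⁾_* κ_1ⁱ = (ν ∘ Ψ⁽ⁱ⁾) κ̃_1ⁱ` and
`Φ⁽ⁱ⁾_* κ_2ⁱ = (η ∘ Ψ⁽ⁱ⁾) κ̃_1ⁱ + (μ ∘ Ψ⁽ⁱ⁾) κ̃_2ⁱ`, where `Ψ⁽ⁱ⁾` is the inverse of `Φ⁽ⁱ⁾`,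
with smooth functions `ν`, `η`, `μ`. -/
structure Multipliers (σ τ : ℕ → Prolongation) (i : ℕ) (Φᵢ : OpenPartialHomeomorph (E i) (E i))
    (ν η μ : E i → ℝ) : Prop where
  smooth_ν : ContDiffOn ℝ ∞ ν Φᵢ.source
  smooth_η : ContDiffOn ℝ ∞ η Φᵢ.source
  smooth_μ : ContDiffOn ℝ ∞ μ Φᵢ.source
  push₁ : ∀ x ∈ Φᵢ.source, fderiv ℝ Φᵢ x (kr₁ i x) = ν x • kr₁ i (Φᵢ x)
  push₂ : ∀ x ∈ Φᵢ.source, fderiv ℝ Φᵢ x (kr₂ σ i x) =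
    η x • kr₁ i (Φᵢ x) + μ x • kr₂ τ i (Φᵢ x)

end Goursat

end

open Goursat

/-! The derived flag and the characteristic distributions of its members are defined by brackets of
local sections, so a contact transformation carries them, and with them all the sets $S^{(i)}_j$, to
those of the target (`IsContact.derivedFlag`, `IsContact.cartanC`, `IsContact.mem_singularSet_iff`).
Hence the singularity types agree, and they may be read off at the origin of the Kumpera–Ruiz normal
forms.

For $\kappa^n$ the flag is explicit: $\mathcal D^{(n-3-m)}$ is spanned by $\kappa^{m+3}$ and the
later coordinate fields, and its characteristic distribution is tangent to the fibres of $\mathbb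
R^n\to\mathbb R^{m+3}$ (`derived_levelDist`, `characteristic_levelDist`). Both facts come from one
formula, `lieBracket_section`: modulo the distribution, the bracket of two sections is an explicit
multiple of `krStep`. At the origin, $\mathcal D^{(i)}=\mathcal C_{i+1}$ exactly when the
corresponding prolongation is singular, so the letters $a_1$ mark the singular steps
(`singularityType_krDist_iff`).

Since $\Phi$ preserves the tangent spaces of these fibres, on a ball its first $i$ components depend
on the first $i$ coordinates only (`PreservesFlag.exists_tower`). Each $\Phi^{(i)}$ inherits the
preservation of the flag, which gives the multipliers; for $i\ge4$ it also preserves the line of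
$\kappa^i_1$, so no $\lambda_i$ occurs.

The recursion comes from projecting the relation for $\Phi^{(k+1)}_*\kappa_2^{k+1}$ to $\mathbb
R^k$. There $\tilde\kappa_1^{k+1}$ disappears, while $\kappa_2^{k+1}$ and $\tilde\kappa_2^{k+1}$
become combinations of $\kappa_1^k,\kappa_2^k$ and $\tilde\kappa_1^k,\tilde\kappa_2^k$ with
coefficients given by the new coordinate. Comparing coefficients (`step_regular`, `step_singular`)
yields $\mu_{k+1}$ and $\Phi_{k+1}$; last components yield $\nu_{k+1}$ and $\eta_{k+1}$; evaluation
at the origin yields $\tilde c_{k+1}$. Uniqueness (`contact_unique`) uses the same projection: its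
direction is determined by $\Phi^{(k)}$ and encodes the type of the next step, its constant and the
next component. -/

namespace Goursat

/-! ### Invariance of the derived flag and of the singularity type under contact transformations -/

section Naturality

variable {n : ℕ} {M : Type*} [TopologicalSpace M] [ChartedSpace (E n) M]
  {M' : Type*} [TopologicalSpace M'] [ChartedSpace (E n) M']
  {M'' : Type*} [TopologicalSpace M''] [ChartedSpace (E n) M'']

theorem IsContact.mdifferentiable {D : Distribution n M} {D' : Distribution n M'}
    {φ : OpenPartialHomeomorph M M'} (h : IsContact D D' φ) :
    φ.MDifferentiable (𝓡 n) (𝓡 n) :=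
  ⟨h.smooth.mdifferentiableOn (by simp), h.smooth_symm.mdifferentiableOn (by simp)⟩

theorem mfderiv_mfderiv_symm {φ : OpenPartialHomeomorph M M'}
    (h : φ.MDifferentiable (𝓡 n) (𝓡 n)) {q : M} (hq : q ∈ φ.source)
    (w : TangentSpace (𝓡 n) (φ q)) :
    (mfderiv (𝓡 n) (𝓡 n) φ q (mfderiv (𝓡 n) (𝓡 n) φ.symm (φ q) w) : E n) = w :=
  (h.mfderiv hq).apply_symm_apply w

theorem mfderiv_symm_mfderiv {φ : OpenPartialHomeomorph M M'}
    (h : φ.MDifferentiable (𝓡 n) (𝓡 n)) {q : M} (hq : q ∈ φ.source)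
    (w : TangentSpace (𝓡 n) q) :
    (mfderiv (𝓡 n) (𝓡 n) φ.symm (φ q) (mfderiv (𝓡 n) (𝓡 n) φ q w) : E n) = w :=
  (h.mfderiv hq).symm_apply_apply w

/-- The differentials of `φ` and `φ.symm` are mutually inverse, so two inclusions of the same kind
give equality. Constructions based on local sections thus only have to be pulled back, and
`IsContact.symm` supplies the second inclusion. -/
theorem isContact_of_le {φ : OpenPartialHomeomorph M M'} {D : Distribution n M}
    {D' : Distribution n M'} (h₁ : ContMDiffOn (𝓡 n) (𝓡 n) ∞ φ φ.source)
    (h₂ : ContMDiffOn (𝓡 n) (𝓡 n) ∞ φ.symm φ.target)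
    (h₃ : ∀ q ∈ φ.source, D' (φ q) ≤ (D q).map (mfderiv (𝓡 n) (𝓡 n) φ q).toLinearMap)
    (h₄ : ∀ r ∈ φ.target, D (φ.symm r) ≤
      (D' r).map (mfderiv (𝓡 n) (𝓡 n) φ.symm r).toLinearMap) : IsContact D D' φ := by
  have hd : φ.MDifferentiable (𝓡 n) (𝓡 n) :=
    ⟨h₁.mdifferentiableOn (by simp), h₂.mdifferentiableOn (by simp)⟩
  refine ⟨h₁, h₂, fun q hq => le_antisymm ?_ (h₃ q hq)⟩
  rintro _ ⟨v, hv, rfl⟩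
  have hv' : (v : E n) ∈ (D (φ.symm (φ q)) : Submodule ℝ (E n)) := by
    rw [φ.left_inv hq]; exact hv
  obtain ⟨w, hw, hwv⟩ := h₄ (φ q) (φ.map_source hq) hv'
  have : (mfderiv (𝓡 n) (𝓡 n) φ q v : E n) = w := by
    rw [← mfderiv_mfderiv_symm hd hq w]
    exact congrArg (mfderiv (𝓡 n) (𝓡 n) φ q) hwv.symm
  have hw' : (mfderiv (𝓡 n) (𝓡 n) φ q v : E n) ∈ (D' (φ q) : Submodule ℝ (E n)) := this ▸ hw
  exact hw'

theorem IsContact.symm {D : Distribution n M} {D' : Distribution n M'}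
    {φ : OpenPartialHomeomorph M M'} (h : IsContact D D' φ) : IsContact D' D φ.symm := by
  have hd := h.mdifferentiable
  refine isContact_of_le h.smooth_symm h.smooth ?_ ?_
  · intro r hr v hv
    have hs : φ.symm r ∈ φ.source := φ.map_target hr
    refine ⟨mfderiv (𝓡 n) (𝓡 n) φ (φ.symm r) v, ?_, ?_⟩
    · have h1 := h.map_eq (φ.symm r) hs
      have h2 : (mfderiv (𝓡 n) (𝓡 n) φ (φ.symm r) v : E n) ∈
          (D' (φ (φ.symm r)) : Submodule ℝ (E n)) := by
        have := h1.le (Submodule.mem_map_of_mem hv)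
        exact this
      rw [φ.right_inv hr] at h2
      exact h2
    · have := mfderiv_symm_mfderiv hd hs v
      rw [φ.right_inv hr] at this
      exact this
  · intro q hq v hv
    have := (h.map_eq q hq).ge hv
    exact this

theorem IsContact.trans {D : Distribution n M} {D' : Distribution n M'} {D'' : Distribution n M''}
    {φ : OpenPartialHomeomorph M M'} {ψ : OpenPartialHomeomorph M' M''}
    (h : IsContact D D' φ) (h' : IsContact D' D'' ψ) : IsContact D D'' (φ.trans ψ) := by
  refine ⟨?_, ?_, ?_⟩
  · refine h'.smooth.comp (h.smooth.mono fun q hq => ?_) fun q hq => ?_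
    · exact (OpenPartialHomeomorph.trans_source φ ψ ▸ hq).1
    · exact (OpenPartialHomeomorph.trans_source φ ψ ▸ hq).2
  · refine h.smooth_symm.comp (h'.smooth_symm.mono fun q hq => ?_) fun q hq => ?_
    · exact (OpenPartialHomeomorph.trans_target φ ψ ▸ hq).1
    · exact (OpenPartialHomeomorph.trans_target φ ψ ▸ hq).2
  · intro q hq
    rw [OpenPartialHomeomorph.trans_source] at hq
    have e1 : mfderiv (𝓡 n) (𝓡 n) (φ.trans ψ) q =
        (mfderiv (𝓡 n) (𝓡 n) ψ (φ q)).comp (mfderiv (𝓡 n) (𝓡 n) φ q) :=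
      mfderiv_comp q (h'.mdifferentiable.mdifferentiableAt hq.2)
        (h.mdifferentiable.mdifferentiableAt hq.1)
    have e2 := h.map_eq q hq.1
    have e3 := h'.map_eq (φ q) hq.2
    rw [e1]
    rw [← e2] at e3
    exact (Submodule.map_comp _ _ _).trans e3

/-- The pull-back of a vector field by a local diffeomorphism. -/
noncomputable abbrev pull (φ : OpenPartialHomeomorph M M') (g : VField n M') : VField n M :=
  VectorField.mpullback (𝓡 n) (𝓡 n) φ g

theorem mfderiv_pull {φ : OpenPartialHomeomorph M M'} (h : φ.MDifferentiable (𝓡 n) (𝓡 n))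
    (g : VField n M') {q : M} (hq : q ∈ φ.source) :
    mfderiv (𝓡 n) (𝓡 n) φ q (pull φ g q) = g (φ q) := by
  have hi : (mfderiv (𝓡 n) (𝓡 n) φ q).IsInvertible := ⟨h.mfderiv hq, rfl⟩
  exact hi.self_apply_inverse _

section Smooth

variable [IsManifold (𝓡 n) ∞ M] [IsManifold (𝓡 n) ∞ M']

theorem IsContact.isSectionOn_pull {D : Distribution n M} {D' : Distribution n M'}
    {φ : OpenPartialHomeomorph M M'} (h : IsContact D D' φ) {g : VField n M'} {U : Set M'}
    (hg : IsSectionOn D' g U) : IsSectionOn D (pull φ g) (φ.source ∩ φ ⁻¹' U) := by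
  have hd := h.mdifferentiable
  refine ⟨fun q hq => ?_, fun q hq => ?_⟩
  · have hi : (mfderiv (𝓡 n) (𝓡 n) φ q).IsInvertible := ⟨hd.mfderiv hq.1, rfl⟩
    have := ContMDiffWithinAt.mpullback_vectorField_preimage (n := ∞) (m := ∞) (hg.1 (φ q) hq.2)
      (h.smooth.contMDiffAt (φ.open_source.mem_nhds hq.1)) hi (by simp)
    exact this.mono inter_subset_right
  · obtain ⟨v, hv, hvq⟩ := (h.map_eq q hq.1).ge (hg.2 (φ q) hq.2)
    have : pull φ g q = v :=
      hd.mfderiv_injective hq.1 ((mfderiv_pull hd g hq.1).trans hvq.symm)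
    rwa [this]

theorem mfderiv_mlieBracket_pull {φ : OpenPartialHomeomorph M M'}
    (hd : φ.MDifferentiable (𝓡 n) (𝓡 n)) (hφ : ContMDiffOn (𝓡 n) (𝓡 n) ∞ φ φ.source)
    {f g : VField n M'} {U : Set M'} (hU : IsOpen U) (hf : SmoothOn f U) (hg : SmoothOn g U)
    {q : M} (hq : q ∈ φ.source) (hqU : φ q ∈ U) :
    mfderiv (𝓡 n) (𝓡 n) φ q (VectorField.mlieBracket (𝓡 n) (pull φ f) (pull φ g) q) =
      VectorField.mlieBracket (𝓡 n) f g (φ q) := by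
  have : IsManifold (𝓡 n) (minSmoothness ℝ 3) M := by
    rw [minSmoothness_of_isRCLikeNormedField]
    exact IsManifold.of_le (n := ∞) ENat.LEInfty.out
  have : IsManifold (𝓡 n) (minSmoothness ℝ 3) M' := by
    rw [minSmoothness_of_isRCLikeNormedField]
    exact IsManifold.of_le (n := ∞) ENat.LEInfty.out
  have : IsManifold (𝓡 n) (minSmoothness ℝ 2) M := by
    rw [minSmoothness_of_isRCLikeNormedField]
    exact IsManifold.of_le (n := ∞) ENat.LEInfty.out
  have : IsManifold (𝓡 n) (minSmoothness ℝ 2) M' := by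
    rw [minSmoothness_of_isRCLikeNormedField]
    exact IsManifold.of_le (n := ∞) ENat.LEInfty.out
  rw [← mfderiv_pull hd (VectorField.mlieBracket (𝓡 n) f g) hq]
  congr 1
  symm
  exact VectorField.mpullback_mlieBracket (n := ∞)
    ((hf.contMDiffAt (hU.mem_nhds hqU)).mdifferentiableAt (by simp))
    ((hg.contMDiffAt (hU.mem_nhds hqU)).mdifferentiableAt (by simp))
    (hφ.contMDiffAt (φ.open_source.mem_nhds hq))
    (by rw [minSmoothness_of_isRCLikeNormedField]; exact ENat.LEInfty.out)

theorem IsContact.derived_le {D : Distribution n M} {D' : Distribution n M'}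
    {φ : OpenPartialHomeomorph M M'} (h : IsContact D D' φ) (q : M) (hq : q ∈ φ.source) :
    Goursat.derived D' (φ q) ≤
      (Goursat.derived D q).map (mfderiv (𝓡 n) (𝓡 n) φ q).toLinearMap := by
  refine sup_le ?_ (Submodule.span_le.2 ?_)
  · rw [← h.map_eq q hq]
    exact Submodule.map_mono le_sup_left
  · rintro _ ⟨U, hU, hqU, f, g, hf, hg, rfl⟩
    refine ⟨VectorField.mlieBracket (𝓡 n) (pull φ f) (pull φ g) q, ?_, ?_⟩
    · refine Submodule.mem_sup_right (Submodule.subset_span ⟨φ.source ∩ φ ⁻¹' U,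
        φ.isOpen_inter_preimage hU, ⟨hq, hqU⟩, _, _, h.isSectionOn_pull hf,
        h.isSectionOn_pull hg, rfl⟩)
    · exact mfderiv_mlieBracket_pull h.mdifferentiable h.smooth hU hf.1 hg.1 hq hqU

theorem IsContact.derived {D : Distribution n M} {D' : Distribution n M'}
    {φ : OpenPartialHomeomorph M M'} (h : IsContact D D' φ) :
    IsContact (Goursat.derived D) (Goursat.derived D') φ :=
  isContact_of_le h.smooth h.smooth_symm h.derived_le h.symm.derived_le

theorem IsContact.derivedFlag {D : Distribution n M} {D' : Distribution n M'}
    {φ : OpenPartialHomeomorph M M'} (h : IsContact D D' φ) (i : ℕ) :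
    IsContact (Goursat.derivedFlag D i) (Goursat.derivedFlag D' i) φ := by
  induction i with
  | zero => exact h
  | succ i ih => exact ih.derived

/-- A test section of `D` is transported to `D'`, bracketed with `f` there, and the result is pulled
back. Transporting back and forth returns the test section only near the point, which suffices
because a bracket depends on germs. -/
theorem IsContact.isCharacteristicOn_pull {D : Distribution n M} {D' : Distribution n M'}
    {φ : OpenPartialHomeomorph M M'} (h : IsContact D D' φ) {f : VField n M'} {U : Set M'}
    (hf : IsCharacteristicOn D' f U) :
    IsCharacteristicOn D (pull φ f) (φ.source ∩ φ ⁻¹' U) := by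
  refine ⟨h.isSectionOn_pull hf.1, fun V hV hVU g hg q hq => ?_⟩
  have hqs : q ∈ φ.source := (hVU hq).1
  have hqU : φ q ∈ U := (hVU hq).2
  have hd := h.mdifferentiable
  have hV' : IsOpen (φ.target ∩ φ.symm ⁻¹' V) := φ.symm.isOpen_inter_preimage hV
  have hsub : φ.target ∩ φ.symm ⁻¹' V ⊆ U := fun r hr => by
    have := (hVU hr.2).2
    rwa [mem_preimage, φ.right_inv hr.1] at this
  have hmem : φ q ∈ φ.target ∩ φ.symm ⁻¹' V :=
    ⟨φ.map_source hqs, by rwa [mem_preimage, φ.left_inv hqs]⟩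
  have hg' := h.symm.isSectionOn_pull hg
  have h1 := hf.2 _ hV' hsub _ hg' (φ q) hmem
  have hev : (fun r => pull φ (pull φ.symm g) r) =ᶠ[𝓝 q] g := by
    filter_upwards [φ.open_source.mem_nhds hqs] with r hr
    apply hd.mfderiv_injective hr
    rw [mfderiv_pull hd _ hr]
    have e1 := mfderiv_pull hd.symm g (φ.map_source hr)
    have e2 := mfderiv_mfderiv_symm hd hr (pull φ.symm g (φ r))
    refine Eq.trans ?_ (congrArg (fun x : E n => (mfderiv (𝓡 n) (𝓡 n) φ r x : E n))
      (e1.trans ?_))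
    · exact e2.symm
    · exact congrArg (fun x => (g x : E n)) (φ.left_inv hr)
  rw [← mfderiv_mlieBracket_pull hd h.smooth hV' (hf.1.1.mono hsub) hg'.1 hqs hmem] at h1
  obtain ⟨v, hv, hvq⟩ := (h.map_eq q hqs).ge h1
  have h3 := (Filter.EventuallyEq.refl (𝓝 q) (pull φ f)).mlieBracket_vectorField_eq (I := 𝓡 n) hev
  rw [← h3]
  have h4 := hd.mfderiv_injective hqs hvq
  rwa [← h4]

theorem IsContact.characteristic_le {D : Distribution n M} {D' : Distribution n M'}
    {φ : OpenPartialHomeomorph M M'} (h : IsContact D D' φ) (q : M) (hq : q ∈ φ.source) :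
    Goursat.characteristic D' (φ q) ≤
      (Goursat.characteristic D q).map (mfderiv (𝓡 n) (𝓡 n) φ q).toLinearMap := by
  refine Submodule.span_le.2 ?_
  rintro _ ⟨U, hU, hqU, f, hf, rfl⟩
  refine ⟨pull φ f q, Submodule.subset_span ⟨φ.source ∩ φ ⁻¹' U,
    φ.isOpen_inter_preimage hU, ⟨hq, hqU⟩, _, h.isCharacteristicOn_pull hf, rfl⟩,
    mfderiv_pull h.mdifferentiable f hq⟩

theorem IsContact.characteristic {D : Distribution n M} {D' : Distribution n M'}
    {φ : OpenPartialHomeomorph M M'} (h : IsContact D D' φ) :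
    IsContact (Goursat.characteristic D) (Goursat.characteristic D') φ :=
  isContact_of_le h.smooth h.smooth_symm h.characteristic_le h.symm.characteristic_le

theorem IsContact.cartanC {D : Distribution n M} {D' : Distribution n M'}
    {φ : OpenPartialHomeomorph M M'} (h : IsContact D D' φ) (i : ℕ) :
    IsContact (Goursat.cartanC D i) (Goursat.cartanC D' i) φ :=
  (h.derivedFlag (i + 1)).characteristic

omit [IsManifold (𝓡 n) ∞ M] [IsManifold (𝓡 n) ∞ M'] in
theorem mfderiv_mem_tangentSet {φ : OpenPartialHomeomorph M M'}
    (hφ : ContMDiffOn (𝓡 n) (𝓡 n) ∞ φ φ.source) {S : Set M} {S' : Set M'}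
    (hS : ∀ r ∈ φ.source, r ∈ S → φ r ∈ S') {q : M} (hq : q ∈ φ.source)
    {v : TangentSpace (𝓡 n) q} (hv : v ∈ tangentSet S q) :
    mfderiv (𝓡 n) (𝓡 n) φ q v ∈ tangentSet S' (φ q) := by
  obtain ⟨γ, rfl, hγ, hγS, rfl⟩ := hv
  have hφ' := hφ.contMDiffAt (φ.open_source.mem_nhds hq)
  refine ⟨φ ∘ γ, rfl, hφ'.comp 0 hγ, ?_, ?_⟩
  · filter_upwards [hγS, hγ.continuousAt (φ.open_source.mem_nhds hq)] with t ht ht'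
    exact hS _ ht' ht
  · rw [mfderiv_comp 0 (hφ'.mdifferentiableAt (by simp)) (hγ.mdifferentiableAt (by simp))]
    rfl

/-- The induction on `j` runs over all points of the source at once: tangent vectors of the previous
set are velocities of curves, and composing such a curve with `φ` requires the correspondence of the
sets along the whole curve. -/
theorem IsContact.mem_singularSet_iff {D : Distribution n M} {D' : Distribution n M'}
    {φ : OpenPartialHomeomorph M M'} (h : IsContact D D' φ) (i j : ℕ) :
    ∀ q ∈ φ.source, q ∈ singularSet D i j ↔ φ q ∈ singularSet D' i j := by
  have hd := h.mdifferentiable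
  induction j with
  | zero =>
    intro q hq
    refine and_congr_right fun _ => ?_
    rw [← (h.derivedFlag i).map_eq q hq, ← (h.cartanC (i + 1)).map_eq q hq]
    exact (Submodule.map_injective_of_injective (hd.mfderiv_injective hq)).eq_iff.symm
  | succ j ih =>
    intro q hq
    refine and_congr_right fun _ => and_congr (ih q hq) (not_congr ?_)
    have hT : mfderiv (𝓡 n) (𝓡 n) φ q '' tangentSet (singularSet D i j) q =
        tangentSet (singularSet D' i j) (φ q) := by
      apply Subset.antisymm
      · rintro _ ⟨v, hv, rfl⟩
        exact mfderiv_mem_tangentSet h.smooth (fun r hr => (ih r hr).1) hq hv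
      · intro w hw
        have h1 := mfderiv_mem_tangentSet (φ := φ.symm) h.smooth_symm
          (S' := singularSet D i j) (fun r hr hrS => (ih _ (φ.map_target hr)).2
            (by rwa [φ.right_inv hr])) (φ.map_source hq) hw
        have h2 : (mfderiv (𝓡 n) (𝓡 n) φ.symm (φ q) w : E n) ∈
            (tangentSet (singularSet D i j) q : Set (E n)) := by
          rw [φ.left_inv hq] at h1
          exact h1
        exact ⟨_, h2, mfderiv_mfderiv_symm hd hq w⟩
    rw [← hT, ← (h.derivedFlag (i - (j + 1))).map_eq q hq,
      ← (h.cartanC (i - (j + 1))).map_eq q hq]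
    have hinj := hd.mfderiv_injective hq
    have e : ∀ (A B C : Set (TangentSpace (𝓡 n) q)),
        mfderiv (𝓡 n) (𝓡 n) φ q '' A ∩ mfderiv (𝓡 n) (𝓡 n) φ q '' B =
          mfderiv (𝓡 n) (𝓡 n) φ q '' C ↔ A ∩ B = C := fun A B C => by
      rw [← image_inter hinj]
      exact hinj.image_injective.eq_iff
    exact (e _ _ _).symm

theorem IsContact.singularityType_eq {D : Distribution n M} {D' : Distribution n M'}
    {φ : OpenPartialHomeomorph M M'} (h : IsContact D D' φ) {q : M} (hq : q ∈ φ.source) :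
    singularityType D q = singularityType D' (φ q) := by
  classical
  have key : ∀ i, singularityLetter D q i = singularityLetter D' (φ q) i := fun i =>
    congrArg (fun P : ℕ → Prop => if h : ∃ j, P j then Nat.find h + 1 else 0)
      (funext fun j => propext (h.mem_singularSet_iff (i + j) j q hq))
  simp only [singularityType, key]

/-- The letter $a_1$ means that the least admissible `j` is zero, so it involves $S_0^{(i)}$ alone
and no tangency condition. -/
theorem singularityType_getElem?_eq_one_iff (D : Distribution n M) (q : M) {k : ℕ}
    (hk : 4 ≤ k) (hkn : k + 1 ≤ n) :
    (singularityType D q)[k + 1 - 4]? = some 1 ↔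
      derivedFlag D (n - (k + 1)) q = cartanC D (n - (k + 1) + 1) q := by
  have h1 : k + 1 - 4 < n - 3 := by omega
  have h2 : n - 4 - (k + 1 - 4) = n - (k + 1) := by omega
  have h3 : n - (k + 1) + 5 ≤ n := by omega
  classical
  have h4 : singularityLetter D q (n - (k + 1)) = 1 ↔
      q ∈ singularSet D (n - (k + 1)) 0 := by
    unfold singularityLetter
    split_ifs with h
    · exact Nat.add_eq_right.trans (Nat.find_eq_zero h)
    · exact iff_of_false (by simp) fun h' => h ⟨0, h'⟩
  have h5 : (singularityType D q)[k + 1 - 4]? = some (singularityLetter D q (n - (k + 1))) := by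
    rw [singularityType, List.getElem?_map, List.getElem?_range h1, Option.map_some, h2]
  rw [h5, Option.some_inj, h4]
  exact and_iff_right h3

end Smooth

end Naturality

/-! ### Derived flag and characteristic distributions of the normal forms -/

noncomputable section Coordinates

/-- The coordinate of index `k` on `ℝⁿ`, which is zero for `k ≥ n`. -/
def co (n k : ℕ) : E n →L[ℝ] ℝ :=
  if h : k < n then EuclideanSpace.proj ⟨k, h⟩ else 0

/-- The coordinate vector of index `k` in `ℝⁿ`, which is zero for `k ≥ n`. -/
def bv (n k : ℕ) : E n :=
  if h : k < n then EuclideanSpace.single ⟨k, h⟩ 1 else 0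

theorem co_apply {n k : ℕ} (h : k < n) (x : E n) : co n k x = x ⟨k, h⟩ := by
  simp [co, h]

theorem co_of_le {n k : ℕ} (h : n ≤ k) (x : E n) : co n k x = 0 := by
  simp [co, not_lt.2 h]

theorem co_bv (n k l : ℕ) : co n k (bv n l) = if k = l ∧ l < n then 1 else 0 := by
  by_cases hl : l < n
  · by_cases hk : k < n
    · rw [co_apply hk]
      simp [bv, hl, Fin.ext_iff]
    · rw [co_of_le (not_lt.1 hk)]
      simp only [hl, and_true]
      rw [if_neg (by omega)]
  · simp [bv, hl]

theorem co_bv_of_ne {n k l : ℕ} (h : k ≠ l) : co n k (bv n l) = 0 := by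
  rw [co_bv, if_neg fun h' => h h'.1]

theorem co_bv_self {n k : ℕ} (h : k < n) : co n k (bv n k) = 1 := by
  rw [co_bv, if_pos ⟨rfl, h⟩]

theorem ext_co {n : ℕ} {x y : E n} (h : ∀ k, co n k x = co n k y) : x = y := by
  ext ⟨k, hk⟩
  rw [← co_apply hk, ← co_apply hk, h k]

/-- The vectors whose first `m` coordinates vanish. -/
def vert (n m : ℕ) : Submodule ℝ (E n) where
  carrier := {w | ∀ k < m, co n k w = 0}
  add_mem' := fun ha hb k hk => by rw [map_add, ha k hk, hb k hk, add_zero]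
  zero_mem' := fun k _ => map_zero _
  smul_mem' := fun c x hx k hk => by rw [map_smul, hx k hk, smul_zero]

theorem vert_anti (n : ℕ) {m m' : ℕ} (h : m ≤ m') : vert n m' ≤ vert n m :=
  fun _ hw k hk => hw k (hk.trans_le h)

theorem bv_mem_vert {n m k : ℕ} (h : m ≤ k) : bv n k ∈ vert n m :=
  fun l hl => co_bv_of_ne (by omega)

theorem sub_smul_bv_mem_vert (n m : ℕ) (w : E n) (hw : w ∈ vert n m) :
    w - co n m w • bv n m ∈ vert n (m + 1) := by
  intro k hk
  rcases Nat.lt_succ_iff_lt_or_eq.1 hk with hk | rfl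
  · simp [hw k hk, co_bv_of_ne hk.ne]
  · by_cases hkn : k < n
    · simp [co_bv_self hkn]
    · simp [co_of_le (not_lt.1 hkn)]

/-- The lift to `ℝⁿ` of the vector field `κ_2ⁱ`, `i = m + 3`. -/
def krField (σ : ℕ → Prolongation) (n : ℕ) : ℕ → E n → E n
  | 0 => fun x => bv n 0 + co n 2 x • bv n 1
  | m + 1 => fun x =>
    match σ (m + 4) with
    | Prolongation.regular c => (co n (m + 3) x + c) • bv n (m + 2) + krField σ n m x
    | Prolongation.singular => bv n (m + 2) + co n (m + 3) x • krField σ n m x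

/-- The bracket of `κ_1ⁱ` and `κ_2ⁱ`, `i = m + 3`, lifted to `ℝⁿ`. -/
def krStep (σ : ℕ → Prolongation) (n : ℕ) : ℕ → E n → E n
  | 0 => fun _ => bv n 1
  | m + 1 => fun x =>
    match σ (m + 4) with
    | Prolongation.regular _ => bv n (m + 2)
    | Prolongation.singular => krField σ n m x

variable {σ : ℕ → Prolongation} {n : ℕ}

theorem krField_zero (x : E n) : krField σ n 0 x = bv n 0 + co n 2 x • bv n 1 := rfl

theorem krField_regular {m : ℕ} {c : ℝ} (h : σ (m + 4) = Prolongation.regular c) (x : E n) :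
    krField σ n (m + 1) x = (co n (m + 3) x + c) • bv n (m + 2) + krField σ n m x := by
  simp only [krField, h]

theorem krField_singular {m : ℕ} (h : σ (m + 4) = Prolongation.singular) (x : E n) :
    krField σ n (m + 1) x = bv n (m + 2) + co n (m + 3) x • krField σ n m x := by
  simp only [krField, h]

theorem krStep_regular {m : ℕ} {c : ℝ} (h : σ (m + 4) = Prolongation.regular c) (x : E n) :
    krStep σ n (m + 1) x = bv n (m + 2) := by
  simp only [krStep, h]

theorem krStep_singular {m : ℕ} (h : σ (m + 4) = Prolongation.singular) (x : E n) :
    krStep σ n (m + 1) x = krField σ n m x := by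
  simp only [krStep, h]

theorem co_krField {m k : ℕ} (h : m + 2 ≤ k) (x : E n) : co n k (krField σ n m x) = 0 := by
  induction m with
  | zero => simp [krField_zero, co_bv_of_ne (show k ≠ 0 by omega), co_bv_of_ne (show k ≠ 1 by omega)]
  | succ m ih =>
    have h1 := ih (by omega)
    have h2 : co n k (bv n (m + 2)) = 0 := co_bv_of_ne (by omega)
    cases hs : σ (m + 4) with
    | regular c => simp [krField_regular hs, h1, h2]
    | singular => simp [krField_singular hs, h1, h2]

/-- A singular step creates a coordinate equal to one, and a regular step keeps the earlier
coordinates. So $\kappa_2$ is nowhere vertical, and its coefficient in a section can be found by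
division. -/
theorem exists_co_krField_ne {m : ℕ} (h : m + 3 ≤ n) (x : E n) :
    ∃ k < m + 2, co n k (krField σ n m x) ≠ 0 := by
  induction m with
  | zero =>
    refine ⟨0, by omega, ?_⟩
    simp [krField_zero, co_bv_self (show 0 < n by omega), co_bv_of_ne (show 0 ≠ 1 by omega)]
  | succ m ih =>
    cases hs : σ (m + 4) with
    | regular c =>
      obtain ⟨k, hk, hk'⟩ := ih (by omega)
      refine ⟨k, by omega, ?_⟩
      simpa [krField_regular hs, co_bv_of_ne hk.ne] using hk'
    | singular =>
      refine ⟨m + 2, by omega, ?_⟩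
      simp [krField_singular hs, co_bv_self (show m + 2 < n by omega), co_krField le_rfl]

theorem contDiff_krField (σ : ℕ → Prolongation) (n m : ℕ) : ContDiff ℝ ∞ (krField σ n m) := by
  induction m with
  | zero =>
    exact contDiff_const.add ((co n 2).contDiff.smul contDiff_const)
  | succ m ih =>
    cases hs : σ (m + 4) with
    | regular c =>
      rw [funext (krField_regular hs)]
      exact (((co n (m + 3)).contDiff.add contDiff_const).smul contDiff_const).add ih
    | singular =>
      rw [funext (krField_singular hs)]
      exact contDiff_const.add ((co n (m + 3)).contDiff.smul ih)

theorem differentiable_krField (σ : ℕ → Prolongation) (n m : ℕ) :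
    Differentiable ℝ (krField σ n m) :=
  (contDiff_krField σ n m).differentiable (by simp)

/-- The field depends on the coordinates of index at most `m + 2`, and affinely on the last of
these; a vertical direction sees only that one. -/
theorem fderiv_krField {m : ℕ} (x : E n) {v : E n} (hv : v ∈ vert n (m + 2)) :
    fderiv ℝ (krField σ n m) x v = co n (m + 2) v • krStep σ n m x := by
  induction m with
  | zero =>
    have : HasFDerivAt (krField σ n 0) ((co n 2).smulRight (bv n 1)) x :=
      ((co n 2).hasFDerivAt.smul_const (bv n 1)).const_add _
    rw [this.fderiv]
    rfl
  | succ m ih =>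
    have h1 := ih (vert_anti n (by omega) hv)
    rw [hv (m + 2) (by omega), zero_smul] at h1
    have hd := (differentiable_krField σ n m x).hasFDerivAt
    cases hs : σ (m + 4) with
    | regular c =>
      have : HasFDerivAt (krField σ n (m + 1)) ((co n (m + 3)).smulRight (bv n (m + 2)) +
          fderiv ℝ (krField σ n m) x) x := by
        rw [funext (krField_regular hs)]
        exact (((co n (m + 3)).hasFDerivAt.add_const c).smul_const (bv n (m + 2))).add hd
      rw [this.fderiv, krStep_regular hs, _root_.add_apply, h1, add_zero]
      rfl
    | singular =>
      have : HasFDerivAt (krField σ n (m + 1)) (co n (m + 3) x • fderiv ℝ (krField σ n m) x +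
          (co n (m + 3)).smulRight (krField σ n m x)) x := by
        rw [funext (krField_singular hs)]
        exact ((co n (m + 3)).hasFDerivAt.smul hd).const_add _
      rw [this.fderiv, krStep_singular hs, _root_.add_apply,
        _root_.smul_apply, h1, smul_zero, zero_add]
      rfl

/-- The span at `x` of `κⁱ`, `i = m + 3`, and the coordinate fields of index greater than `i`. -/
def levelSub (σ : ℕ → Prolongation) (n m : ℕ) (x : E n) : Submodule ℝ (E n) :=
  vert n (m + 2) ⊔ Submodule.span ℝ {krField σ n m x}

/-- The distribution on `ℝⁿ` spanned by `κⁱ`, `i = m + 3`, and the coordinate fields of index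
greater than `i`. -/
def levelDist (σ : ℕ → Prolongation) (n m : ℕ) : Distribution n (E n) := levelSub σ n m

theorem mem_levelSub {m : ℕ} {x w : E n} :
    w ∈ levelSub σ n m x ↔
      ∃ a : ℝ, ∀ k < m + 2, co n k w = a * co n k (krField σ n m x) := by
  constructor
  · intro h
    obtain ⟨v, hv, u, hu, rfl⟩ := Submodule.mem_sup.1 h
    obtain ⟨a, rfl⟩ := Submodule.mem_span_singleton.1 hu
    exact ⟨a, fun k hk => by simp [hv k hk]⟩
  · rintro ⟨a, ha⟩
    refine Submodule.mem_sup.2 ⟨w - a • krField σ n m x, fun k hk => ?_, a • krField σ n m x,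
      Submodule.smul_mem _ _ (Submodule.mem_span_singleton_self _), sub_add_cancel _ _⟩
    simp [ha k hk]

theorem krField_mem_levelSub {m : ℕ} (x : E n) :
    krField σ n m x ∈ levelSub σ n m x :=
  mem_levelSub.2 ⟨1, fun _ _ => (one_mul _).symm⟩

theorem vert_le_levelSub {m : ℕ} (x : E n) :
    vert n (m + 2) ≤ levelSub σ n m x :=
  le_sup_left

/-- Near `q` a section is $\alpha\kappa_2$ plus a vertical field. The derivatives of $\alpha$ and of
the vertical part contribute only vectors of the distribution, which leaves $\alpha$ times the
derivative of $\kappa_2$. -/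
theorem fderiv_section {m : ℕ} (hm : m + 3 ≤ n) {f : E n → E n} {q : E n} {a : ℝ}
    (hf : DifferentiableAt ℝ f q)
    (hfs : ∀ᶠ x in 𝓝 q, f x ∈ levelSub σ n m x)
    (ha : ∀ k < m + 2, co n k (f q) = a * co n k (krField σ n m q)) (u : E n) :
    fderiv ℝ f q u - a • fderiv ℝ (krField σ n m) q u ∈
      levelSub σ n m q := by
  obtain ⟨k₀, hk₀, hne⟩ := exists_co_krField_ne (σ := σ) hm q
  have hX := differentiable_krField σ n m q
  have hf₀ : DifferentiableAt ℝ (fun x => co n k₀ (f x)) q := (co n k₀).differentiableAt.comp q hf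
  have hX₀ : DifferentiableAt ℝ (fun x => co n k₀ (krField σ n m x)) q :=
    (co n k₀).differentiableAt.comp q hX
  -- The pointwise coefficients need not vary smoothly by definition; a quotient of coordinates
  -- shows that they do.
  set α : E n → ℝ := fun x => co n k₀ (f x) * (co n k₀ (krField σ n m x))⁻¹ with hα
  have hαd : DifferentiableAt ℝ α q := hf₀.mul (hX₀.inv hne)
  have hαq : α q = a := by
    simp only [hα, ha k₀ hk₀]
    field_simp
  refine mem_levelSub.2 ⟨fderiv ℝ α q u, fun k hk => ?_⟩
  have hev : (fun x => co n k (f x)) =ᶠ[𝓝 q] fun x => α x * co n k (krField σ n m x) := by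
    filter_upwards [hfs, hX₀.continuousAt.eventually_ne hne] with x hx hx'
    obtain ⟨b, hb⟩ := mem_levelSub.1 hx
    simp only [hα, hb k hk, hb k₀ hk₀]
    field_simp
  have h1 : HasFDerivAt (fun x => co n k (f x)) ((co n k).comp (fderiv ℝ f q)) q :=
    (co n k).hasFDerivAt.comp q hf.hasFDerivAt
  have h2 : HasFDerivAt (fun x => co n k (krField σ n m x))
      ((co n k).comp (fderiv ℝ (krField σ n m) q)) q :=
    (co n k).hasFDerivAt.comp q hX.hasFDerivAt
  have h3 := congrArg (fun L => L u)
    (h1.unique ((hαd.hasFDerivAt.mul h2).congr_of_eventuallyEq hev))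
  simp only [ContinuousLinearMap.comp_apply, _root_.add_apply,
    _root_.smul_apply, smul_eq_mul, hαq] at h3
  rw [map_sub, map_smul, h3, smul_eq_mul]
  ring

/-- By `fderiv_section` only $b\,D\kappa_2(f)-a\,D\kappa_2(g)$ matters. The two terms
$ab\,D\kappa_2(\kappa_2)$ cancel, and the vertical parts are differentiated by `fderiv_krField`. -/
theorem lieBracket_section {m : ℕ} (hm : m + 3 ≤ n) {f g : E n → E n} {q : E n} {a b : ℝ}
    (hf : DifferentiableAt ℝ f q) (hg : DifferentiableAt ℝ g q)
    (hfs : ∀ᶠ x in 𝓝 q, f x ∈ levelSub σ n m x)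
    (hgs : ∀ᶠ x in 𝓝 q, g x ∈ levelSub σ n m x)
    (ha : ∀ k < m + 2, co n k (f q) = a * co n k (krField σ n m q))
    (hb : ∀ k < m + 2, co n k (g q) = b * co n k (krField σ n m q)) :
    VectorField.lieBracket ℝ f g q -
      (b * co n (m + 2) (f q) - a * co n (m + 2) (g q)) • krStep σ n m q ∈
      levelSub σ n m q := by
  have h1 := fderiv_section hm hf hfs ha (g q)
  have h2 := fderiv_section hm hg hgs hb (f q)
  have hva : f q - a • krField σ n m q ∈ vert n (m + 2) := fun k hk => by simp [ha k hk]
  have hvb : g q - b • krField σ n m q ∈ vert n (m + 2) := fun k hk => by simp [hb k hk]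
  have h3 := fderiv_krField (σ := σ) q hva
  have h4 := fderiv_krField (σ := σ) q hvb
  simp only [map_sub, map_smul, co_krField le_rfl, smul_zero, sub_zero] at h3 h4
  have h5 := Submodule.sub_mem _ h2 h1
  convert! h5 using 1
  rw [sub_eq_iff_eq_add] at h3 h4
  rw [h3, h4, VectorField.lieBracket]
  module

/-- After a prolongation, `krStep` and `krField` form an invertible combination of the previous
$\kappa_1$ and $\kappa_2$, so they remain independent modulo vertical vectors. -/
theorem krStep_notMem {m : ℕ} (hm : m + 3 ≤ n) (x : E n) :
    krStep σ n m x ∉ levelSub σ n m x := by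
  rw [mem_levelSub]
  rintro ⟨a, ha⟩
  cases m with
  | zero =>
    have h0 := ha 0 (by omega)
    have h1 := ha 1 (by omega)
    simp [krStep, krField_zero, co_bv_self (show 0 < n by omega),
      co_bv_self (show 1 < n by omega), co_bv_of_ne (show 0 ≠ 1 by omega),
      co_bv_of_ne (show 1 ≠ 0 by omega)] at h0 h1
    rw [← h0] at h1
    simp at h1
  | succ m =>
    obtain ⟨k, hk, hk'⟩ := exists_co_krField_ne (σ := σ) (show m + 3 ≤ n by omega) x
    have h0 := ha k (by omega)
    have h1 := ha (m + 2) (by omega)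
    have e1 : co n (m + 2) (bv n (m + 2)) = 1 := co_bv_self (by omega)
    have e2 : co n k (bv n (m + 2)) = 0 := co_bv_of_ne hk.ne
    have e3 : co n (m + 2) (krField σ n m x) = 0 := co_krField le_rfl x
    cases hs : σ (m + 4) with
    | regular c =>
      simp [krStep_regular hs, krField_regular hs, e1, e2, e3, hk'] at h0 h1
      simp [h0] at h1
    | singular =>
      simp [krStep_singular hs, krField_singular hs, e1, e2, e3] at h0 h1
      simp [← h1, hk'] at h0

theorem krStep_mem_levelSub {m : ℕ} (x : E n) :
    krStep σ n (m + 1) x ∈ levelSub σ n m x := by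
  cases hs : σ (m + 4) with
  | regular c =>
    rw [krStep_regular hs]
    exact vert_le_levelSub x (bv_mem_vert le_rfl)
  | singular =>
    rw [krStep_singular hs]
    exact krField_mem_levelSub x

theorem krField_succ_mem_levelSub {m : ℕ} (x : E n) :
    krField σ n (m + 1) x ∈ levelSub σ n m x := by
  have h : bv n (m + 2) ∈ levelSub σ n m x :=
    vert_le_levelSub x (bv_mem_vert le_rfl)
  cases hs : σ (m + 4) with
  | regular c =>
    rw [krField_regular hs]
    exact add_mem (Submodule.smul_mem _ _ h) (krField_mem_levelSub x)
  | singular =>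
    rw [krField_singular hs]
    exact add_mem h (Submodule.smul_mem _ _ (krField_mem_levelSub x))

theorem levelSub_succ_le {m : ℕ} (x : E n) :
    levelSub σ n (m + 1) x ≤ levelSub σ n m x :=
  sup_le ((vert_anti n (by omega)).trans (vert_le_levelSub x))
    (Submodule.span_le.2 (singleton_subset_iff.2 (krField_succ_mem_levelSub x)))

theorem levelSub_le_of_krStep_mem {m : ℕ} {x : E n} {S : Submodule ℝ (E n)}
    (h : levelSub σ n (m + 1) x ≤ S) (hS : krStep σ n (m + 1) x ∈ S) :
    levelSub σ n m x ≤ S := by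
  have hX := h (krField_mem_levelSub x)
  have key : bv n (m + 2) ∈ S ∧ krField σ n m x ∈ S := by
    cases hs : σ (m + 4) with
    | regular c =>
      rw [krStep_regular hs] at hS
      rw [krField_regular hs] at hX
      exact ⟨hS, (Submodule.add_mem_iff_right _ (Submodule.smul_mem _ _ hS)).1 hX⟩
    | singular =>
      rw [krStep_singular hs] at hS
      rw [krField_singular hs] at hX
      exact ⟨(Submodule.add_mem_iff_left _ (Submodule.smul_mem _ _ hS)).1 hX, hS⟩
  refine sup_le (fun v hv => ?_) (Submodule.span_le.2 (singleton_subset_iff.2 key.2))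
  have := h (vert_le_levelSub x (sub_smul_bv_mem_vert n (m + 2) v hv))
  exact (Submodule.sub_mem_iff_left _ (Submodule.smul_mem _ _ key.1)).1 this

theorem smoothOn_iff {f : VField n (E n)} {U : Set (E n)} :
    SmoothOn f U ↔ ContDiffOn ℝ ∞ (f : E n → E n) U :=
  contMDiffOn_vectorSpace_iff_contDiffOn

theorem IsSectionOn.differentiableAt {D : Distribution n (E n)} {f : VField n (E n)}
    {U : Set (E n)} (hf : IsSectionOn D f U) (hU : IsOpen U) {q : E n} (hq : q ∈ U) :
    DifferentiableAt ℝ (f : E n → E n) q :=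
  ((smoothOn_iff.1 hf.1).contDiffAt (hU.mem_nhds hq)).differentiableAt (by simp)

theorem isSectionOn_krField (σ : ℕ → Prolongation) (n m : ℕ) :
    IsSectionOn (levelDist σ n m) (krField σ n m) univ :=
  ⟨smoothOn_iff.2 (contDiff_krField σ n m).contDiffOn, fun q _ => krField_mem_levelSub q⟩

theorem isSectionOn_const {m : ℕ} {v : E n} (hv : v ∈ vert n (m + 2)) :
    IsSectionOn (levelDist σ n m) (fun _ => v) univ :=
  ⟨smoothOn_iff.2 contDiffOn_const, fun q _ => vert_le_levelSub q hv⟩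

theorem mlieBracket_eq_lieBracket (f g : VField n (E n)) (q : E n) :
    VectorField.mlieBracket (𝓡 n) f g q =
      VectorField.lieBracket ℝ (f : E n → E n) (g : E n → E n) q := by
  have h := congrFun (VectorField.mlieBracketWithin_eq_lieBracketWithin (𝕜 := ℝ) (E := E n)
    (V := f) (W := g) (s := univ)) q
  have h1 := congrFun (VectorField.mlieBracketWithin_univ (I := 𝓡 n) (V := f) (W := g)) q
  have h2 := congrFun (VectorField.lieBracketWithin_univ (𝕜 := ℝ) (V := (f : E n → E n))
    (W := (g : E n → E n))) q
  exact h1.symm.trans (h.trans h2)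

theorem mlieBracket_mem {D : Distribution n (E n)} {f g : VField n (E n)} {q : E n} :
    VectorField.mlieBracket (𝓡 n) f g q ∈ D q ↔
      VectorField.lieBracket ℝ (f : E n → E n) (g : E n → E n) q ∈
        (D q : Submodule ℝ (E n)) :=
  iff_of_eq (congrArg (fun v : E n => v ∈ (D q : Submodule ℝ (E n)))
    (mlieBracket_eq_lieBracket f g q))

theorem lieBracket_const_krField {m : ℕ} (q : E n) {v : E n} (hv : v ∈ vert n (m + 2)) :
    VectorField.lieBracket ℝ (fun _ => v) (krField σ n m) q =
      co n (m + 2) v • krStep σ n m q := by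
  rw [VectorField.lieBracket, fderiv_krField q hv]
  simp

theorem derived_levelDist {m : ℕ} (hm : m + 4 ≤ n) :
    derived (levelDist σ n (m + 1)) = levelDist σ n m := by
  funext q
  refine le_antisymm (sup_le (levelSub_succ_le q) (Submodule.span_le.2 ?_)) ?_
  · rintro _ ⟨U, hU, hqU, f, g, hf, hg, rfl⟩
    refine mlieBracket_mem.2 ?_
    obtain ⟨a, ha⟩ := mem_levelSub.1 (hf.2 q hqU)
    obtain ⟨b, hb⟩ := mem_levelSub.1 (hg.2 q hqU)
    have h := lieBracket_section (show m + 1 + 3 ≤ n by omega) (hf.differentiableAt hU hqU)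
      (hg.differentiableAt hU hqU) (eventually_of_mem (hU.mem_nhds hqU) hf.2)
      (eventually_of_mem (hU.mem_nhds hqU) hg.2) ha hb
    exact (Submodule.sub_mem_iff_left _
      (Submodule.smul_mem (levelSub σ n m q) _ (krStep_mem_levelSub q))).1 (levelSub_succ_le q h)
  -- The single bracket $[\kappa_1,\kappa_2]$ is `krStep`, which generates the whole next member of
  -- the flag.
  · have h := lieBracket_const_krField (σ := σ) (m := m + 1) q
      (bv_mem_vert (n := n) (k := m + 3) le_rfl)
    rw [co_bv_self (by omega), one_smul] at h
    have hmem : ∀ v : TangentSpace (𝓡 n) q, VectorField.mlieBracket (𝓡 n)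
        (fun _ => bv n (m + 3) : VField n (E n)) (krField σ n (m + 1)) q = v →
        v ∈ derived (levelDist σ n (m + 1)) q := fun v hv =>
      Submodule.mem_sup_right (Submodule.subset_span ⟨univ, isOpen_univ, mem_univ _, _, _,
        isSectionOn_const (bv_mem_vert le_rfl), isSectionOn_krField σ n (m + 1), hv.symm⟩)
    have hle : ∀ v : TangentSpace (𝓡 n) q, v ∈ levelDist σ n (m + 1) q →
        v ∈ derived (levelDist σ n (m + 1)) q := fun v hv => Submodule.mem_sup_left hv
    exact levelSub_le_of_krStep_mem hle
      (hmem (krStep σ n (m + 1) q) ((mlieBracket_eq_lieBracket _ _ q).trans h))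

/-- Since `krStep` is not in the distribution, its coefficient in `lieBracket_section` must vanish
for every test field. Testing with $\kappa_2$ kills the coordinate of index `m + 2` of the field,
and testing with $\kappa_1$ kills its $\kappa_2$-coefficient. -/
theorem characteristic_levelDist {m : ℕ} (hm : m + 3 ≤ n) :
    characteristic (levelDist σ n m) = fun _ => vert n (m + 3) := by
  funext q
  refine le_antisymm (Submodule.span_le.2 ?_) fun v hv => ?_
  · rintro _ ⟨U, hU, hqU, f, hf, rfl⟩
    obtain ⟨a, ha⟩ := mem_levelSub.1 (hf.1.2 q hqU)
    have key : ∀ g : VField n (E n), IsSectionOn (levelDist σ n m) g univ → ∀ b : ℝ,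
        (∀ k < m + 2, co n k (g q) = b * co n k (krField σ n m q)) →
        b * co n (m + 2) (f q) - a * co n (m + 2) (g q) = 0 := by
      intro g hg b hb
      have h1 := hf.2 U hU subset_rfl g ⟨hg.1.mono (subset_univ _), fun r _ => hg.2 r trivial⟩
        q hqU
      replace h1 := mlieBracket_mem.1 h1
      have h2 := lieBracket_section hm (hf.1.differentiableAt hU hqU)
        (hg.differentiableAt isOpen_univ (mem_univ q))
        (eventually_of_mem (hU.mem_nhds hqU) hf.1.2)
        (Eventually.of_forall fun r => hg.2 r trivial) ha hb
      by_contra hne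
      have h3 := (Submodule.sub_mem_iff_right (levelSub σ n m q) h1).1 h2
      exact krStep_notMem hm q ((Submodule.smul_mem_iff (levelSub σ n m q) hne).1 h3)
    have h1 := key _ (isSectionOn_krField σ n m) 1 fun k _ => (one_mul _).symm
    have h2 := key _ (isSectionOn_const (bv_mem_vert le_rfl)) 0 fun k hk => by
      rw [co_bv_of_ne hk.ne, zero_mul]
    rw [co_krField le_rfl] at h1
    rw [co_bv_self (by omega)] at h2
    intro k hk
    rcases Nat.lt_succ_iff_lt_or_eq.1 hk with hk | rfl
    · rw [ha k hk]
      have : a = 0 := by linarith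
      rw [this, zero_mul]
    · linarith
  · replace hv : (v : E n) ∈ vert n (m + 3) := hv
    have hv2 : (v : E n) ∈ vert n (m + 2) := vert_anti n (by omega) hv
    refine Submodule.subset_span ⟨univ, isOpen_univ, mem_univ _, fun _ => v,
      ⟨isSectionOn_const hv2, fun V hV _ g hg r hr => mlieBracket_mem.2 ?_⟩, rfl⟩
    obtain ⟨b, hb⟩ := mem_levelSub.1 (hg.2 r hr)
    have h := lieBracket_section (σ := σ) hm (f := fun _ => (v : E n)) (a := 0) (differentiableAt_const _)
      (hg.differentiableAt hV hr) (Eventually.of_forall fun x => vert_le_levelSub x hv2)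
      (eventually_of_mem (hV.mem_nhds hr) hg.2)
      (fun k hk => by rw [hv2 k hk, zero_mul]) hb
    rw [hv (m + 2) (by omega)] at h
    rw [mul_zero, zero_mul, sub_zero, zero_smul, sub_zero] at h
    exact h

theorem derivedFlag_levelDist {m : ℕ} (hm : m + 3 ≤ n) {j : ℕ} (hj : j ≤ m) :
    derivedFlag (levelDist σ n m) j = levelDist σ n (m - j) := by
  induction j with
  | zero => rfl
  | succ j ih =>
    have h : m - j = m - (j + 1) + 1 := by omega
    rw [derivedFlag, ih (by omega), h, derived_levelDist (by omega)]

theorem cartanC_levelDist {m : ℕ} (hm : m + 3 ≤ n) {j : ℕ} (hj : j + 1 ≤ m) :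
    cartanC (levelDist σ n m) j = fun _ => vert n (m - (j + 1) + 3) := by
  rw [cartanC, derivedFlag_levelDist hm hj, characteristic_levelDist (by omega)]

/-- At the origin the new coordinate vanishes, so a singular $\kappa_2$ reduces to a coordinate
vector, while a regular one retains the nonvertical previous $\kappa_2$. -/
theorem levelSub_zero_eq_vert_iff {m : ℕ} (hm : m + 5 ≤ n) :
    levelSub σ n (m + 2) 0 = vert n (m + 3) ↔
      σ (m + 5) = Prolongation.singular := by
  cases hs : σ (m + 5) with
  | regular c =>
    refine iff_of_false (fun h => ?_) (by simp)
    have h1 : krField σ n (m + 2) 0 ∈ vert n (m + 3) := h ▸ krField_mem_levelSub 0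
    obtain ⟨k, hk, hk'⟩ := exists_co_krField_ne (σ := σ) (show m + 1 + 3 ≤ n by omega) 0
    have h2 := h1 k hk
    rw [krField_regular hs] at h2
    simp [co_bv_of_ne hk.ne, hk'] at h2
  | singular =>
    refine iff_of_true (le_antisymm (sup_le (vert_anti n (by omega)) ?_) fun v hv => ?_) rfl
    · rw [Submodule.span_le, singleton_subset_iff, krField_singular hs]
      simpa using bv_mem_vert (n := n) (show m + 3 ≤ m + 1 + 2 by omega)
    · have h1 : bv n (m + 3) ∈ levelSub σ n (m + 2) 0 := by
        have := krField_mem_levelSub (σ := σ) (m := m + 2) (0 : E n)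
        rw [krField_singular hs] at this
        simpa using this
      have h2 := vert_le_levelSub (σ := σ) (0 : E n) (sub_smul_bv_mem_vert n (m + 3) v hv)
      exact (Submodule.sub_mem_iff_left _ (Submodule.smul_mem _ _ h1)).1 h2

end Coordinates

/-! ### Projections between the spaces, and the normal forms in coordinates -/

noncomputable section Resize

/-- The linear map `ℝⁱ → ℝⁿ` that truncates vectors or extends them by zero. -/
def resize (i n : ℕ) : E i →L[ℝ] E n :=
  LinearMap.toContinuousLinearMap
    { toFun := fun x => WithLp.toLp 2 fun k : Fin n => co i k x
      map_add' := fun x y => by ext k; simp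
      map_smul' := fun c x => by ext k; simp }

theorem co_resize {i n k : ℕ} (h : k < n) (x : E i) : co n k (resize i n x) = co i k x := by
  rw [co_apply h]
  rfl

theorem proj_eq_resize {i n : ℕ} (h : i ≤ n) : (proj h : E n → E i) = resize n i := by
  funext x
  ext ⟨k, hk⟩
  rw [← co_apply hk, ← co_apply hk, co_resize hk, co_apply hk, co_apply (hk.trans_le h)]
  rfl

theorem resize_resize {i j n : ℕ} (h : i ≤ j) (x : E n) :
    resize j i (resize n j x) = resize n i x := by
  refine ext_co fun k => ?_
  by_cases hk : k < i
  · rw [co_resize hk, co_resize hk, co_resize (hk.trans_le h)]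
  · rw [co_of_le (not_lt.1 hk), co_of_le (not_lt.1 hk)]

theorem resize_self {n : ℕ} (x : E n) : resize n n x = x := by
  refine ext_co fun k => ?_
  by_cases hk : k < n
  · rw [co_resize hk]
  · rw [co_of_le (not_lt.1 hk), co_of_le (not_lt.1 hk)]

theorem resize_resize_self {i n : ℕ} (h : i ≤ n) (y : E i) : resize n i (resize i n y) = y := by
  refine ext_co fun k => ?_
  by_cases hk : k < i
  · rw [co_resize hk, co_resize (hk.trans_le h)]
  · rw [co_of_le (not_lt.1 hk), co_of_le (not_lt.1 hk)]

theorem resize_eq_resize_iff {i n : ℕ} {x y : E n} :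
    resize n i x = resize n i y ↔ ∀ k < i, co n k x = co n k y := by
  refine ⟨fun h k hk => ?_, fun h => ext_co fun k => ?_⟩
  · rw [← co_resize hk, h, co_resize hk]
  · by_cases hk : k < i
    · rw [co_resize hk, co_resize hk, h k hk]
    · rw [co_of_le (not_lt.1 hk), co_of_le (not_lt.1 hk)]

theorem isOpenMap_resize {i n : ℕ} (h : i ≤ n) : IsOpenMap (resize n i) :=
  (resize n i).isOpenMap fun y => ⟨resize i n y, resize_resize_self h y⟩

/-- Balls around the origin are stable under setting the later coordinates to zero, which provides a
section of the projection inside the ball. -/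
theorem norm_resize_resize_le {i n : ℕ} (x : E n) : ‖resize i n (resize n i x)‖ ≤ ‖x‖ := by
  rw [EuclideanSpace.norm_eq, EuclideanSpace.norm_eq]
  refine Real.sqrt_le_sqrt (Finset.sum_le_sum fun k _ => ?_)
  rw [← co_apply k.2, ← co_apply k.2 x, co_resize k.2]
  by_cases hk : (k : ℕ) < i
  · rw [co_resize hk]
  · rw [co_of_le (not_lt.1 hk)]
    rw [norm_zero]
    exact pow_le_pow_left₀ le_rfl (norm_nonneg _) 2

theorem resize_bv {i n k : ℕ} (hk : k < i) (hn : i ≤ n) : resize n i (bv n k) = bv i k := by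
  refine ext_co fun l => ?_
  by_cases hl : l < i
  · rw [co_resize hl, co_bv, co_bv]
    simp [hk, hk.trans_le hn]
  · rw [co_of_le (not_lt.1 hl), co_of_le (not_lt.1 hl)]

theorem resize_bv_of_le {i n k : ℕ} (hk : i ≤ k) : resize n i (bv n k) = 0 := by
  refine ext_co fun l => ?_
  by_cases hl : l < i
  · rw [co_resize hl, co_bv_of_ne (by omega), map_zero]
  · rw [co_of_le (not_lt.1 hl), co_of_le (not_lt.1 hl)]

variable {σ : ℕ → Prolongation}

theorem resize_krField {i n m : ℕ} (hm : m + 3 ≤ i) (hn : i ≤ n) (x : E n) :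
    resize n i (krField σ n m x) = krField σ i m (resize n i x) := by
  induction m with
  | zero =>
    simp only [krField_zero, map_add, map_smul]
    rw [resize_bv (by omega) hn, resize_bv (by omega) hn, co_resize (by omega)]
  | succ m ih =>
    have h1 := ih (by omega)
    have h2 : resize n i (bv n (m + 2)) = bv i (m + 2) := resize_bv (by omega) hn
    have h3 : co i (m + 3) (resize n i x) = co n (m + 3) x := co_resize (by omega) x
    cases hs : σ (m + 4) with
    | regular c => simp only [krField_regular hs, map_add, map_smul, h1, h2, h3]
    | singular => simp only [krField_singular hs, map_add, map_smul, h1, h2, h3]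

theorem co_last (k : ℕ) (z : E (k + 1)) : co (k + 1) k z = z (Fin.last k) := co_apply _ _

theorem kr₁_succ (k : ℕ) (y : E (k + 1)) : kr₁ (k + 1) y = bv (k + 1) k := by
  simp [kr₁, bv, Fin.last]

theorem incl_eq_resize {n : ℕ} (v : E n) : incl v = resize n (n + 1) v := by
  ext k
  refine Fin.lastCases ?_ (fun k => ?_) k
  · rw [← co_last, ← co_last, co_resize (Nat.lt_succ_self n), co_of_le le_rfl, co_last]
    simp [incl]
  · have h1 : (k : ℕ) < n + 1 := k.2.trans (Nat.lt_succ_self n)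
    have h2 := co_apply h1 (resize n (n + 1) v)
    rw [co_resize h1, co_apply k.2] at h2
    refine Eq.trans ?_ h2
    simp [incl]

theorem resize_succ_krField {n m : ℕ} (h : m + 2 ≤ n) (x : E (n + 1)) :
    resize n (n + 1) (resize (n + 1) n (krField σ (n + 1) m x)) = krField σ (n + 1) m x := by
  refine ext_co fun k => ?_
  rcases lt_trichotomy k n with hk | rfl | hk
  · rw [co_resize (by omega), co_resize hk]
  · rw [co_resize (by omega), co_of_le le_rfl, co_krField h]
  · rw [co_of_le (by omega), co_of_le (by omega)]

theorem kr₂_eq_krField (σ : ℕ → Prolongation) (m : ℕ) (y : E (m + 3)) :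
    kr₂ σ (m + 3) y = krField σ (m + 3) m y := by
  induction m with
  | zero =>
    rw [krField_zero]
    ext k
    fin_cases k <;> simp [kr₂, bv, co]
  | succ m ih =>
    have h1 : lift (kr₁ (m + 3)) y = bv (m + 4) (m + 2) := by
      rw [lift, incl_eq_resize, kr₁_succ]
      refine ext_co fun k => ?_
      by_cases hk : k < m + 4
      · rw [co_resize hk, co_bv, co_bv]
        simp
      · rw [co_of_le (not_lt.1 hk), co_of_le (not_lt.1 hk)]
    have h2 : lift (kr₂ σ (m + 3)) y = krField σ (m + 4) m y := by
      rw [lift, incl_eq_resize, ih, proj_eq_resize, ← resize_krField le_rfl (Nat.le_succ _),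
        resize_succ_krField (by omega)]
    cases hs : σ (m + 4) with
    | regular c =>
      rw [krField_regular hs, ← h1, ← h2]
      change kr₂ σ (m + 4) y = _
      simp only [kr₂, hs]
      rw [← co_last]
    | singular =>
      rw [krField_singular hs, ← h1, ← h2]
      change kr₂ σ (m + 4) y = _
      simp only [kr₂, hs]
      rw [← co_last]

theorem contDiff_kr₂ (σ : ℕ → Prolongation) {k : ℕ} (hk : 3 ≤ k) : ContDiff ℝ ∞ (kr₂ σ k) := by
  obtain ⟨m, rfl⟩ := Nat.exists_eq_add_of_le' hk
  rw [funext (kr₂_eq_krField σ m)]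
  exact contDiff_krField σ _ m

theorem resize_kr₂_regular {k : ℕ} (hk : 3 ≤ k) {c : ℝ}
    (h : σ (k + 1) = Prolongation.regular c) (z : E (k + 1)) :
    resize (k + 1) k (kr₂ σ (k + 1) z) =
      (z (Fin.last k) + c) • kr₁ k (resize (k + 1) k z) + kr₂ σ k (resize (k + 1) k z) := by
  obtain ⟨m, rfl⟩ := Nat.exists_eq_add_of_le' hk
  rw [kr₂_eq_krField σ m, kr₁_succ, ← co_last]
  refine (congrArg (resize (m + 4) (m + 3)) (kr₂_eq_krField σ (m + 1) z)).trans ?_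
  rw [krField_regular h, map_add, map_smul, resize_bv (by omega) (by omega),
    resize_krField le_rfl (by omega)]

theorem resize_kr₂_singular {k : ℕ} (hk : 3 ≤ k)
    (h : σ (k + 1) = Prolongation.singular) (z : E (k + 1)) :
    resize (k + 1) k (kr₂ σ (k + 1) z) =
      kr₁ k (resize (k + 1) k z) + z (Fin.last k) • kr₂ σ k (resize (k + 1) k z) := by
  obtain ⟨m, rfl⟩ := Nat.exists_eq_add_of_le' hk
  rw [kr₂_eq_krField σ m, kr₁_succ, ← co_last]
  refine (congrArg (resize (m + 4) (m + 3)) (kr₂_eq_krField σ (m + 1) z)).trans ?_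
  rw [krField_singular h, map_add, map_smul, resize_bv (by omega) (by omega),
    resize_krField le_rfl (by omega)]

theorem kr₂_last {k : ℕ} (hk : 2 ≤ k) (z : E (k + 1)) : kr₂ σ (k + 1) z (Fin.last k) = 0 := by
  obtain ⟨m, rfl⟩ := Nat.exists_eq_add_of_le' hk
  rw [← co_last]
  refine (congrArg (co (m + 3) (m + 2)) (kr₂_eq_krField σ m z)).trans (co_krField le_rfl z)

/-- The last coordinate isolates $\kappa_1$, and a nonzero lower coordinate isolates $\kappa_2$. -/
theorem kr_unique {k : ℕ} (hk : 3 ≤ k) {y : E k} {a b a' b' : ℝ}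
    (h : a • kr₁ k y + b • kr₂ σ k y = a' • kr₁ k y + b' • kr₂ σ k y) : a = a' ∧ b = b' := by
  obtain ⟨m, rfl⟩ := Nat.exists_eq_add_of_le' hk
  rw [kr₂_eq_krField σ m, kr₁_succ] at h
  obtain ⟨l, hl, hne⟩ := exists_co_krField_ne (σ := σ) (le_refl (m + 3)) y
  have h1 := congrArg (co (m + 3) (m + 2)) h
  have h2 := congrArg (co (m + 3) l) h
  simp only [map_add, map_smul, co_krField le_rfl, co_bv_self (Nat.lt_succ_self (m + 2)),
    co_bv_of_ne hl.ne, smul_eq_mul, mul_zero, mul_one, add_zero, zero_add] at h1 h2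
  exact ⟨h1, mul_right_cancel₀ hne h2⟩

theorem kr₂_ne_zero {k : ℕ} (hk : 3 ≤ k) (y : E k) : kr₂ σ k y ≠ 0 := fun h =>
  one_ne_zero (kr_unique (σ := σ) hk (y := y) (a := 0) (b := 1) (a' := 0) (b' := 0)
    (by simp [h])).2

theorem krDist_eq_levelDist (σ : ℕ → Prolongation) {n : ℕ} (hn : 3 ≤ n) :
    krDist σ n = levelDist σ n (n - 3) := by
  obtain ⟨m, rfl⟩ := Nat.exists_eq_add_of_le' hn
  rw [Nat.add_sub_cancel]
  funext y
  have h : Submodule.span ℝ ({kr₁ (m + 3) y, kr₂ σ (m + 3) y} : Set (E (m + 3))) =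
      levelSub σ (m + 3) m y := by
    rw [kr₂_eq_krField, kr₁_succ, Submodule.span_insert, levelSub]
    congr 1
    refine le_antisymm (Submodule.span_le.2 (singleton_subset_iff.2 (bv_mem_vert le_rfl)))
      fun v hv => Submodule.mem_span_singleton.2 ⟨co (m + 3) (m + 2) v, ?_⟩
    have h1 := sub_smul_bv_mem_vert (m + 3) (m + 2) v hv
    symm
    rw [← sub_eq_zero]
    refine ext_co fun k => ?_
    rw [map_zero]
    by_cases hk : k < m + 3
    · exact h1 k hk
    · exact co_of_le (not_lt.1 hk) _
  exact h

theorem mem_levelSub_iff_kr {k m : ℕ} (hk : k = m + 3) {y w : E k} :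
    w ∈ levelSub σ k m y ↔ ∃ a b : ℝ, w = a • kr₁ k y + b • kr₂ σ k y := by
  subst hk
  have h := congrFun (krDist_eq_levelDist σ (Nat.le_add_left 3 m)) y
  rw [Nat.add_sub_cancel] at h
  have h' : levelSub σ (m + 3) m y =
    Submodule.span ℝ ({kr₁ (m + 3) y, kr₂ σ (m + 3) y} : Set (E (m + 3))) := h.symm
  rw [h', Submodule.mem_span_pair]
  exact ⟨fun ⟨a, b, h⟩ => ⟨a, b, h.symm⟩, fun ⟨a, b, h⟩ => ⟨a, b, h.symm⟩⟩

/-- The letter compares $\mathcal D^{(n-k-1)}$, which is the level `k - 2`, with the kernel of the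
projection to $\mathbb R^{k-1}$. -/
theorem singularityType_krDist_iff {n k : ℕ} (hk : 4 ≤ k) (hkn : k + 1 ≤ n) :
    (singularityType (krDist σ n) 0)[k + 1 - 4]? = some 1 ↔
      σ (k + 1) = Prolongation.singular := by
  obtain ⟨m, rfl⟩ := Nat.exists_eq_add_of_le' hk
  rw [singularityType_getElem?_eq_one_iff _ _ hk hkn, krDist_eq_levelDist σ (by omega),
    derivedFlag_levelDist (by omega) (by omega), cartanC_levelDist (by omega) (by omega)]
  have e1 : n - 3 - (n - (m + 4 + 1)) = m + 2 := by omega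
  have e2 : n - 3 - (n - (m + 4 + 1) + 1 + 1) + 3 = m + 3 := by omega
  rw [e1, e2]
  exact levelSub_zero_eq_vert_iff hkn

end Resize

/-! ### Contact transformations of normal forms preserve the flag -/

section Flag

variable {σ τ : ℕ → Prolongation} {n : ℕ}

/-- A diffeomorphism between open sets of `ℝⁿ` whose differential maps the derived flag of `κⁿ`
and its characteristic distributions into those of `κ̃ⁿ`. -/
structure PreservesFlag (σ τ : ℕ → Prolongation) {n : ℕ}
    (Φ : OpenPartialHomeomorph (E n) (E n)) : Prop where
  smooth : ContDiffOn ℝ ∞ Φ Φ.source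
  smooth_symm : ContDiffOn ℝ ∞ Φ.symm Φ.target
  level : ∀ m, m + 3 ≤ n → ∀ z ∈ Φ.source, ∀ u ∈ levelSub σ n m z,
    fderiv ℝ Φ z u ∈ levelSub τ n m (Φ z)
  vert : ∀ m, 3 ≤ m → ∀ z ∈ Φ.source, ∀ u ∈ vert n m, fderiv ℝ Φ z u ∈ vert n m

theorem IsContact.preservesFlag (hn : 3 ≤ n) {Φ : OpenPartialHomeomorph (E n) (E n)}
    (h : IsContact (krDist σ n) (krDist τ n) Φ) : PreservesFlag σ τ Φ := by
  rw [krDist_eq_levelDist σ hn, krDist_eq_levelDist τ hn] at h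
  refine ⟨h.smooth.contDiffOn, h.smooth_symm.contDiffOn, fun m hm z hz u hu => ?_,
    fun m hm z hz u hu => ?_⟩
  · have h1 := (h.derivedFlag (n - 3 - m)).map_eq z hz
    rw [derivedFlag_levelDist (by omega) (by omega), derivedFlag_levelDist (by omega) (by omega),
      Nat.sub_sub_self (by omega)] at h1
    have h2 := h1.le (Submodule.mem_map_of_mem hu)
    rw [mfderiv_eq_fderiv] at h2
    exact h2
  -- For `m ≥ n` the space is zero; otherwise it is $\mathcal C_{n-m-1}$.
  · rcases le_or_gt n m with hnm | hnm
    · have : u = 0 := ext_co fun k => by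
        rw [map_zero]
        by_cases hk : k < m
        · exact hu k hk
        · exact co_of_le (by omega) u
      rw [this, map_zero]
      exact zero_mem _
    · have h1 := (h.cartanC (n - m - 1)).map_eq z hz
      rw [cartanC_levelDist (by omega) (by omega), cartanC_levelDist (by omega) (by omega)] at h1
      have e : n - 3 - (n - m - 1 + 1) + 3 = m := by omega
      rw [e] at h1
      have h2 := h1.le (Submodule.mem_map_of_mem hu)
      rw [mfderiv_eq_fderiv] at h2
      exact h2

theorem fderiv_injective {i : ℕ} {F : OpenPartialHomeomorph (E i) (E i)}
    (h : ContDiffOn ℝ ∞ F F.source) (h' : ContDiffOn ℝ ∞ F.symm F.target) {z : E i}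
    (hz : z ∈ F.source) : Function.Injective (fderiv ℝ F z) := by
  have hd : F.MDifferentiable (𝓡 i) (𝓡 i) :=
    ⟨(h.differentiableOn (by simp)).mdifferentiableOn,
      (h'.differentiableOn (by simp)).mdifferentiableOn⟩
  have := hd.mfderiv_injective hz
  rwa [mfderiv_eq_fderiv] at this

end Flag

/-! ### The triangular structure of the transformation -/

noncomputable section Tower

variable {σ τ : ℕ → Prolongation} {n : ℕ}

/-- Two points with the same projection are joined by a segment in a vertical direction, along which
the projection of `F` has zero derivative. -/
theorem resize_eq_of_fderiv_vert {F : E n → E n} {B : Set (E n)} (hB : Convex ℝ B)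
    {i : ℕ} (hF : ∀ z ∈ B, DifferentiableAt ℝ F z)
    (hv : ∀ z ∈ B, ∀ u ∈ vert n i, fderiv ℝ F z u ∈ vert n i)
    {x y : E n} (hx : x ∈ B) (hy : y ∈ B) (hxy : resize n i x = resize n i y) :
    resize n i (F x) = resize n i (F y) := by
  have hu : y - x ∈ vert n i := fun k hk => by
    rw [map_sub, resize_eq_resize_iff.1 hxy k hk, sub_self]
  have hm : ∀ t ∈ Icc (0 : ℝ) 1, x + t • (y - x) ∈ B := fun t ht => hB.add_smul_sub_mem hx hy ht
  have hd : ∀ t ∈ Icc (0 : ℝ) 1, HasDerivWithinAt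
      (fun t : ℝ => resize n i (F (x + t • (y - x)))) 0 (Icc 0 1) t := by
    intro t ht
    have h1 : HasDerivAt (fun t : ℝ => x + t • (y - x)) (y - x) t := by
      simpa using ((hasDerivAt_id t).smul_const (y - x)).const_add x
    have h2 := ((resize n i).hasFDerivAt.comp_hasDerivAt t
      ((hF _ (hm t ht)).hasFDerivAt.comp_hasDerivAt t h1))
    have h3 : resize n i (fderiv ℝ F (x + t • (y - x)) (y - x)) = 0 := by
      rw [← map_zero (resize n i), resize_eq_resize_iff]
      intro k hk
      rw [hv _ (hm t ht) _ hu k hk, map_zero]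
    rw [h3] at h2
    exact h2.hasDerivWithinAt
  have := (convex_Icc (0 : ℝ) 1).norm_image_sub_le_of_norm_hasDerivWithin_le (C := 0) hd
    (fun t _ => by simp) (left_mem_Icc.2 zero_le_one) (right_mem_Icc.2 zero_le_one)
  simp only [zero_smul, one_smul, add_zero, zero_mul, norm_le_zero_iff, add_sub_cancel,
    sub_eq_zero] at this
  exact this.symm

theorem PreservesFlag.differentiableAt {Φ : OpenPartialHomeomorph (E n) (E n)}
    (h : PreservesFlag σ τ Φ) {z : E n} (hz : z ∈ Φ.source) : DifferentiableAt ℝ Φ z :=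
  (h.smooth.contDiffAt (Φ.open_source.mem_nhds hz)).differentiableAt (by simp)

/-- Extension by zero, then $\Phi$, then projection defines $\Phi^{(i)}$ on the projection of a ball
`W`, and $\Phi^{-1}$ is treated alike. As $\Phi(W)$ need not be convex, the argument for the inverse
runs on a ball of the target that contains it. -/
theorem PreservesFlag.exists_tower {Φ : OpenPartialHomeomorph (E n) (E n)}
    (h : PreservesFlag σ τ Φ) (h' : PreservesFlag τ σ Φ.symm) (h0 : 0 ∈ Φ.source)
    (hΦ0 : Φ 0 = 0) {V : Set (E n)} (hV : V ∈ 𝓝 (0 : E n)) :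
    ∃ W : Set (E n), IsOpen W ∧ 0 ∈ W ∧ W ⊆ V ∧ W ⊆ Φ.source ∧
      ∃ Φs : ∀ i, OpenPartialHomeomorph (E i) (E i), IsTower Φ W Φs := by
  classical
  obtain ⟨ε', hε', hB'⟩ := Metric.mem_nhds_iff.1
    (Φ.open_target.mem_nhds (hΦ0 ▸ Φ.map_source h0))
  have hc : Φ ⁻¹' Metric.ball 0 ε' ∈ 𝓝 (0 : E n) :=
    (Φ.continuousAt h0).preimage_mem_nhds (by rw [hΦ0]; exact Metric.ball_mem_nhds _ hε')
  obtain ⟨ε, hε, hB⟩ := Metric.mem_nhds_iff.1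
    (inter_mem hV (inter_mem (Φ.open_source.mem_nhds h0) hc))
  set W := Metric.ball (0 : E n) ε with hW
  have hWs : W ⊆ Φ.source := fun x hx => (hB hx).2.1
  have hWB : ∀ x ∈ W, Φ x ∈ Metric.ball (0 : E n) ε' := fun x hx => (hB hx).2.2
  have hWo : IsOpen W := Metric.isOpen_ball
  have hret : ∀ (δ : ℝ) (i : ℕ), ∀ x ∈ Metric.ball (0 : E n) δ,
      resize i n (resize n i x) ∈ Metric.ball (0 : E n) δ := fun δ i x hx => by
    rw [mem_ball_zero_iff] at hx ⊢
    exact (norm_resize_resize_le x).trans_lt hx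
  have hfw : ∀ i, 3 ≤ i → i ≤ n → ∀ x ∈ W,
      resize n i (Φ (resize i n (resize n i x))) = resize n i (Φ x) := fun i hi hin x hx =>
    resize_eq_of_fderiv_vert (convex_ball 0 ε) (fun z hz => h.differentiableAt (hWs hz))
      (fun z hz => h.vert i hi z (hWs hz)) (hret ε i x hx) hx (resize_resize_self hin _)
  have hbw : ∀ i, 3 ≤ i → i ≤ n → ∀ x ∈ W,
      resize n i (Φ.symm (resize i n (resize n i (Φ x)))) = resize n i x := fun i hi hin x hx => by
    have := resize_eq_of_fderiv_vert (convex_ball 0 ε') (fun z hz => h'.differentiableAt (hB' hz))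
      (fun z hz => h'.vert i hi z (hB' hz)) (hret ε' i _ (hWB x hx)) (hWB x hx)
      (resize_resize_self hin _)
    rw [this, Φ.left_inv (hWs hx)]
  have hsm : ∀ i, ContDiffOn ℝ ∞ (fun y => resize n i (Φ (resize i n y))) (resize n i '' W) := by
    intro i
    refine (resize n i).contDiff.comp_contDiffOn
      (h.smooth.comp (resize i n).contDiff.contDiffOn ?_)
    rintro _ ⟨x, hx, rfl⟩
    exact hWs (hret ε i x hx)
  have hsm' : ∀ i, ContDiffOn ℝ ∞ (fun y => resize n i (Φ.symm (resize i n y)))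
      (resize n i '' (Φ '' W)) := by
    intro i
    refine (resize n i).contDiff.comp_contDiffOn
      (h.smooth_symm.comp (resize i n).contDiff.contDiffOn ?_)
    rintro _ ⟨_, ⟨x, hx, rfl⟩, rfl⟩
    exact hB' (hret ε' i _ (hWB x hx))
  let G : ∀ i, 3 ≤ i → i ≤ n → OpenPartialHomeomorph (E i) (E i) := fun i hi hin =>
    { toFun := fun y => resize n i (Φ (resize i n y))
      invFun := fun y => resize n i (Φ.symm (resize i n y))
      source := resize n i '' W
      target := resize n i '' (Φ '' W)
      map_source' := by
        rintro _ ⟨x, hx, rfl⟩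
        rw [hfw i hi hin x hx]
        exact mem_image_of_mem _ (mem_image_of_mem _ hx)
      map_target' := by
        rintro _ ⟨_, ⟨x, hx, rfl⟩, rfl⟩
        rw [hbw i hi hin x hx]
        exact mem_image_of_mem _ hx
      left_inv' := by
        rintro _ ⟨x, hx, rfl⟩
        rw [hfw i hi hin x hx, hbw i hi hin x hx]
      right_inv' := by
        rintro _ ⟨_, ⟨x, hx, rfl⟩, rfl⟩
        rw [hbw i hi hin x hx, hfw i hi hin x hx]
      open_source := isOpenMap_resize hin _ hWo
      open_target := isOpenMap_resize hin _ (Φ.isOpen_image_of_subset_source hWo hWs)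
      continuousOn_toFun := (hsm i).continuousOn
      continuousOn_invFun := (hsm' i).continuousOn }
  refine ⟨W, hWo, Metric.mem_ball_self hε, fun x hx => (hB hx).1, hWs,
    fun i => if hi : 3 ≤ i ∧ i ≤ n then G i hi.1 hi.2 else OpenPartialHomeomorph.refl _,
    ?_, ?_, ?_, ?_, ?_⟩
  · intro i hi hin
    rw [dif_pos ⟨hi, hin⟩, proj_eq_resize]
  · intro i hi hin
    rw [dif_pos ⟨hi, hin⟩, proj_eq_resize]
  · intro i hi hin
    rw [dif_pos ⟨hi, hin⟩]
    exact hsm i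
  · intro i hi hin
    rw [dif_pos ⟨hi, hin⟩]
    exact hsm' i
  · intro i hi hin x hx
    rw [dif_pos ⟨hi, hin⟩, proj_eq_resize]
    exact hfw i hi hin x hx

section Facts

variable {Φ : OpenPartialHomeomorph (E n) (E n)} {W : Set (E n)}
  {Φs : ∀ i, OpenPartialHomeomorph (E i) (E i)}

theorem IsTower.exists_resize (hT : IsTower Φ W Φs) {i : ℕ} (hi : 3 ≤ i) (hin : i ≤ n) {y : E i}
    (hy : y ∈ (Φs i).source) : ∃ x ∈ W, resize n i x = y := by
  rw [hT.source_eq i hi hin, proj_eq_resize] at hy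
  exact hy

theorem IsTower.resize_mem (hT : IsTower Φ W Φs) {i : ℕ} (hi : 3 ≤ i) (hin : i ≤ n) {x : E n}
    (hx : x ∈ W) : resize n i x ∈ (Φs i).source := by
  rw [hT.source_eq i hi hin, proj_eq_resize]
  exact mem_image_of_mem _ hx

theorem IsTower.apply_resize (hT : IsTower Φ W Φs) {i : ℕ} (hi : 3 ≤ i) (hin : i ≤ n) {x : E n}
    (hx : x ∈ W) : Φs i (resize n i x) = resize n i (Φ x) := by
  rw [← proj_eq_resize hin]
  exact hT.comm i hi hin x hx

theorem IsTower.differentiableAt (hT : IsTower Φ W Φs) {i : ℕ} (hi : 3 ≤ i) (hin : i ≤ n)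
    {y : E i} (hy : y ∈ (Φs i).source) : DifferentiableAt ℝ (Φs i) y :=
  ((hT.smooth i hi hin).contDiffAt ((Φs i).open_source.mem_nhds hy)).differentiableAt (by simp)

theorem IsTower.fderiv_resize (hT : IsTower Φ W Φs) (hW : IsOpen W) (hWs : W ⊆ Φ.source)
    (h : PreservesFlag σ τ Φ) {i : ℕ} (hi : 3 ≤ i) (hin : i ≤ n) {x : E n} (hx : x ∈ W) (u : E n) :
    fderiv ℝ (Φs i) (resize n i x) (resize n i u) = resize n i (fderiv ℝ Φ x u) := by
  have h1 : HasFDerivAt (fun x => Φs i (resize n i x))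
      ((fderiv ℝ (Φs i) (resize n i x)).comp (resize n i)) x :=
    (hT.differentiableAt hi hin (hT.resize_mem hi hin hx)).hasFDerivAt.comp x
      (resize n i).hasFDerivAt
  have h2 : HasFDerivAt (fun x => resize n i (Φ x)) ((resize n i).comp (fderiv ℝ Φ x)) x :=
    (resize n i).hasFDerivAt.comp x (h.differentiableAt (hWs hx)).hasFDerivAt
  have hev : (fun x => Φs i (resize n i x)) =ᶠ[𝓝 x] fun x => resize n i (Φ x) := by
    filter_upwards [hW.mem_nhds hx] with z hz using hT.apply_resize hi hin hz
  exact congrArg (fun L => L u) (h1.unique (h2.congr_of_eventuallyEq hev))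

/-- A vector is extended by zeros, mapped by the differential of $\Phi$ and projected again; the
conditions involve lower coordinates only, which this does not disturb. -/
theorem IsTower.preservesFlag (hT : IsTower Φ W Φs) (hW : IsOpen W) (hWs : W ⊆ Φ.source)
    (h : PreservesFlag σ τ Φ) {i : ℕ} (hi : 3 ≤ i) (hin : i ≤ n) :
    PreservesFlag σ τ (Φs i) := by
  refine ⟨hT.smooth i hi hin, hT.smooth_symm i hi hin, fun m hm y hy u hu => ?_,
    fun m hm y hy u hu => ?_⟩
  · obtain ⟨x, hx, rfl⟩ := hT.exists_resize hi hin hy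
    obtain ⟨a, ha⟩ := mem_levelSub.1 hu
    have h1 : resize i n u ∈ levelSub σ n m x := mem_levelSub.2 ⟨a, fun k hk => by
      rw [co_resize (by omega), ha k hk, ← resize_krField hm hin, co_resize (by omega)]⟩
    obtain ⟨b, hb⟩ := mem_levelSub.1 (h.level m (hm.trans hin) x (hWs hx) _ h1)
    rw [← resize_resize_self hin u, hT.fderiv_resize hW hWs h hi hin hx]
    refine mem_levelSub.2 ⟨b, fun k hk => ?_⟩
    rw [hT.apply_resize hi hin hx, ← resize_krField hm hin, co_resize (by omega), hb k hk,
      co_resize (by omega)]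
  · obtain ⟨x, hx, rfl⟩ := hT.exists_resize hi hin hy
    intro k hk
    rcases le_or_gt i k with hik | hik
    · exact co_of_le hik _
    · rw [← resize_resize_self hin u, hT.fderiv_resize hW hWs h hi hin hx, co_resize hik]
      by_cases hmi : m ≤ i
      · refine h.vert m hm x (hWs hx) _ (fun l hl => ?_) k hk
        rw [co_resize (by omega), hu l hl]
      · have : u = 0 := ext_co fun l => by
          rw [map_zero]
          by_cases hl : l < m
          · exact hu l hl
          · exact co_of_le (by omega) u
        simp [this]

/-- The relations between consecutive members of a tower. -/
theorem IsTower.succ (hT : IsTower Φ W Φs) (hW : IsOpen W) (hWs : W ⊆ Φ.source)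
    (h : PreservesFlag σ τ Φ) {k : ℕ} (hk : 3 ≤ k) (hkn : k + 1 ≤ n) {z : E (k + 1)}
    (hz : z ∈ (Φs (k + 1)).source) :
    resize (k + 1) k z ∈ (Φs k).source ∧
      Φs k (resize (k + 1) k z) = resize (k + 1) k (Φs (k + 1) z) ∧
      ∀ u, fderiv ℝ (Φs k) (resize (k + 1) k z) (resize (k + 1) k u) =
        resize (k + 1) k (fderiv ℝ (Φs (k + 1)) z u) := by
  have hk1 : k ≤ k + 1 := Nat.le_succ k
  obtain ⟨x, hx, rfl⟩ := hT.exists_resize (by omega) hkn hz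
  rw [resize_resize hk1]
  refine ⟨hT.resize_mem hk (by omega) hx, ?_, fun u => ?_⟩
  · rw [hT.apply_resize hk (by omega) hx, hT.apply_resize (by omega) hkn hx, resize_resize hk1]
  · rw [← resize_resize_self hkn u, hT.fderiv_resize hW hWs h (by omega) hkn hx,
      resize_resize hk1, resize_resize hk1, hT.fderiv_resize hW hWs h hk (by omega) hx]

end Facts

end Tower

/-! ### Existence, uniqueness and recursion of the multipliers -/

section MultiplierLemmas

variable {σ τ : ℕ → Prolongation} {k : ℕ}

theorem kr₁_last (k : ℕ) (z : E (k + 1)) : kr₁ (k + 1) z (Fin.last k) = 1 := by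
  simp [kr₁]

theorem inner_kr₁_kr₂ (hk : 3 ≤ k) (y : E k) : inner ℝ (kr₁ k y) (kr₂ σ k y) = 0 := by
  obtain ⟨m, rfl⟩ := Nat.exists_eq_add_of_le' hk
  have h : kr₁ (m + 3) y = EuclideanSpace.single (Fin.last (m + 2)) 1 := rfl
  rw [h, EuclideanSpace.inner_single_left, kr₂_last (by omega), mul_zero]

/-- Smoothness of the coefficients comes from explicit formulas: $\kappa_1$ is the last unit vector
and is orthogonal to $\kappa_2$, so they are a last coordinate and a quotient of inner products. -/
theorem PreservesFlag.exists_coeff (hk : 3 ≤ k) {F : OpenPartialHomeomorph (E k) (E k)}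
    (hF : PreservesFlag σ τ F) {X : E k → E k} (hX : ContDiff ℝ ∞ X)
    (hXs : ∀ y, X y ∈ levelSub σ k (k - 3) y) :
    ∃ a b : E k → ℝ, ContDiffOn ℝ ∞ a F.source ∧ ContDiffOn ℝ ∞ b F.source ∧
      ∀ y ∈ F.source, fderiv ℝ F y (X y) = a y • kr₁ k (F y) + b y • kr₂ τ k (F y) := by
  have hw : ContDiffOn ℝ ∞ (fun y => fderiv ℝ F y (X y)) F.source :=
    (hF.smooth.fderiv_of_isOpen F.open_source (by simp)).clm_apply hX.contDiffOn
  have hκ : ContDiffOn ℝ ∞ (fun y => kr₂ τ k (F y)) F.source :=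
    (contDiff_kr₂ τ hk).comp_contDiffOn hF.smooth
  refine ⟨fun y => co k (k - 1) (fderiv ℝ F y (X y)),
    fun y => inner ℝ (fderiv ℝ F y (X y)) (kr₂ τ k (F y)) /
      inner ℝ (kr₂ τ k (F y)) (kr₂ τ k (F y)), (co k (k - 1)).contDiff.comp_contDiffOn hw,
    (hw.inner ℝ hκ).div (hκ.inner ℝ hκ) fun y _ => inner_self_ne_zero.2 (kr₂_ne_zero hk _),
    fun y hy => ?_⟩
  obtain ⟨a, b, hab⟩ := (mem_levelSub_iff_kr (by omega)).1
    (hF.level (k - 3) (by omega) y hy _ (hXs y))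
  have h1 : inner ℝ (kr₂ τ k (F y)) (kr₂ τ k (F y)) ≠ 0 := inner_self_ne_zero.2 (kr₂_ne_zero hk _)
  have h2 : co k (k - 1) (fderiv ℝ F y (X y)) = a := by
    obtain ⟨m, rfl⟩ := Nat.exists_eq_add_of_le' hk
    rw [hab, map_add, map_smul, map_smul]
    have e1 : co (m + 3) (m + 3 - 1) (kr₁ (m + 3) (F y)) = 1 :=
      (co_last (m + 2) _).trans (kr₁_last (m + 2) _)
    have e2 : co (m + 3) (m + 3 - 1) (kr₂ τ (m + 3) (F y)) = 0 :=
      (co_last (m + 2) _).trans (kr₂_last (by omega) _)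
    rw [e1, e2]
    simp
  have h3 : inner ℝ (fderiv ℝ F y (X y)) (kr₂ τ k (F y)) /
      inner ℝ (kr₂ τ k (F y)) (kr₂ τ k (F y)) = b := by
    rw [hab, inner_add_left, real_inner_smul_left, real_inner_smul_left, inner_kr₁_kr₂ hk,
      mul_zero, zero_add, mul_div_cancel_right₀ _ h1]
  simp only [h2, h3]
  exact hab

theorem contDiff_kr₁ (k : ℕ) : ContDiff ℝ ∞ (kr₁ k) := by
  cases k with
  | zero => exact contDiff_const
  | succ k => exact contDiff_const

theorem PreservesFlag.exists_multipliers (hk : 3 ≤ k) {F : OpenPartialHomeomorph (E k) (E k)}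
    (hF : PreservesFlag σ τ F) :
    ∃ ν η μ lam : E k → ℝ, ContDiffOn ℝ ∞ ν F.source ∧ ContDiffOn ℝ ∞ η F.source ∧
      ContDiffOn ℝ ∞ μ F.source ∧ ContDiffOn ℝ ∞ lam F.source ∧
      (∀ y ∈ F.source, fderiv ℝ F y (kr₁ k y) = ν y • kr₁ k (F y) + lam y • kr₂ τ k (F y)) ∧
      (∀ y ∈ F.source, fderiv ℝ F y (kr₂ σ k y) = η y • kr₁ k (F y) + μ y • kr₂ τ k (F y)) ∧
      (4 ≤ k → ∀ y ∈ F.source, lam y = 0) := by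
  have hk' : k = k - 3 + 3 := by omega
  obtain ⟨ν, lam, hν, hlam, h1⟩ := hF.exists_coeff hk (contDiff_kr₁ k) fun y =>
    (mem_levelSub_iff_kr hk').2 ⟨1, 0, by simp⟩
  obtain ⟨η, μ, hη, hμ, h2⟩ := hF.exists_coeff hk (contDiff_kr₂ σ hk) fun y =>
    (mem_levelSub_iff_kr hk').2 ⟨0, 1, by simp⟩
  refine ⟨ν, η, μ, lam, hν, hη, hμ, hlam, h1, h2, fun h4 y hy => ?_⟩
  obtain ⟨m, rfl⟩ := Nat.exists_eq_add_of_le' hk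
  -- The line of $\kappa_1^k$ is the kernel of the projection to $\mathbb R^{k-1}$, which is
  -- preserved as soon as `k - 1 ≥ 3`.
  have hv := hF.vert (m + 2) (by omega) y hy (kr₁ (m + 3) y)
    (by rw [kr₁_succ]; exact bv_mem_vert le_rfl)
  obtain ⟨l, hl, hne⟩ := exists_co_krField_ne (σ := τ) (le_refl (m + 3)) (F y)
  have h3 := hv l hl
  rw [h1 y hy, map_add, map_smul, map_smul, kr₁_succ, co_bv_of_ne hl.ne, smul_zero, zero_add,
    kr₂_eq_krField, smul_eq_mul] at h3
  exact (mul_eq_zero.1 h3).resolve_right hne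

/-- Otherwise both images would be multiples of $\tilde\kappa_1$, against the injectivity of the
differential. -/
theorem multipliers_ne_zero (hk : 3 ≤ k) {F : OpenPartialHomeomorph (E k) (E k)}
    {y : E k} (hinj : Function.Injective (fderiv ℝ F y)) {ν η μ : ℝ}
    (h₁ : fderiv ℝ F y (kr₁ k y) = ν • kr₁ k (F y))
    (h₂ : fderiv ℝ F y (kr₂ σ k y) = η • kr₁ k (F y) + μ • kr₂ τ k (F y)) : μ ≠ 0 := by
  rintro rfl
  have h3 : fderiv ℝ F y (η • kr₁ k y + (-ν) • kr₂ σ k y) = fderiv ℝ F y 0 := by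
    rw [map_add, map_smul, map_smul, h₁, h₂, map_zero]
    module
  have h4 := kr_unique (σ := σ) hk (y := y) (a' := 0) (b' := 0)
    ((hinj h3).trans (by simp))
  have hν : ν = 0 := neg_eq_zero.1 h4.2
  have h5 : fderiv ℝ F y (kr₁ k y) = fderiv ℝ F y 0 := by rw [h₁, hν, zero_smul, map_zero]
  have h6 := kr_unique (σ := σ) hk (y := y) (a := 1) (b := 0) (a' := 0) (b' := 0)
    (by simp [hinj h5])
  exact one_ne_zero h6.1

theorem FirstMultipliers.unique {F : OpenPartialHomeomorph (E 3) (E 3)}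
    {ν η μ lam ν' η' μ' lam' : E 3 → ℝ} (h : FirstMultipliers σ τ F ν η μ lam)
    (h' : FirstMultipliers σ τ F ν' η' μ' lam') :
    EqOn ν' ν F.source ∧ EqOn η' η F.source ∧ EqOn μ' μ F.source ∧ EqOn lam' lam F.source := by
  have h1 := fun y hy => kr_unique le_rfl ((h'.push₁ y hy).symm.trans (h.push₁ y hy))
  have h2 := fun y hy => kr_unique le_rfl ((h'.push₂ y hy).symm.trans (h.push₂ y hy))
  exact ⟨fun y hy => (h1 y hy).1, fun y hy => (h2 y hy).1, fun y hy => (h2 y hy).2,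
    fun y hy => (h1 y hy).2⟩

theorem Multipliers.unique (hk : 3 ≤ k) {F : OpenPartialHomeomorph (E k) (E k)}
    {ν η μ ν' η' μ' : E k → ℝ} (h : Multipliers σ τ k F ν η μ)
    (h' : Multipliers σ τ k F ν' η' μ') :
    EqOn ν' ν F.source ∧ EqOn η' η F.source ∧ EqOn μ' μ F.source := by
  have h1 := fun y hy => kr_unique (σ := τ) hk (y := F y) (a := ν' y) (b := 0) (a' := ν y) (b' := 0)
    (by rw [zero_smul, ← h'.push₁ y hy, ← h.push₁ y hy])
  have h2 := fun y hy => kr_unique hk ((h'.push₂ y hy).symm.trans (h.push₂ y hy))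
  exact ⟨fun y hy => (h1 y hy).1, fun y hy => (h2 y hy).1, fun y hy => (h2 y hy).2⟩

theorem fderiv_last {G : E (k + 1) → E (k + 1)} {z : E (k + 1)} (hG : DifferentiableAt ℝ G z)
    (v : E (k + 1)) :
    fderiv ℝ (fun u => G u (Fin.last k)) z v = fderiv ℝ G z v (Fin.last k) := by
  have h : HasFDerivAt (fun u => co (k + 1) k (G u)) ((co (k + 1) k).comp (fderiv ℝ G z)) z :=
    (co (k + 1) k).hasFDerivAt.comp z hG.hasFDerivAt
  simp only [co_last] at h
  rw [h.fderiv, ContinuousLinearMap.comp_apply, co_last]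

theorem Multipliers.last_eq (hk : 3 ≤ k + 1) {G : OpenPartialHomeomorph (E (k + 1)) (E (k + 1))}
    {ν η μ : E (k + 1) → ℝ} (h : Multipliers σ τ (k + 1) G ν η μ) {z : E (k + 1)}
    (hz : z ∈ G.source) (hG : DifferentiableAt ℝ G z) :
    ν z = fderiv ℝ (fun u => G u (Fin.last k)) z (kr₁ (k + 1) z) ∧
      η z = fderiv ℝ (fun u => G u (Fin.last k)) z (kr₂ σ (k + 1) z) := by
  rw [fderiv_last hG, fderiv_last hG, h.push₁ z hz, h.push₂ z hz]
  simp [kr₁_last, kr₂_last (show 2 ≤ k by omega)]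

theorem resize_push₂ {k : ℕ} {G : OpenPartialHomeomorph (E (k + 1)) (E (k + 1))} {z : E (k + 1)}
    {η μ : ℝ} (h : fderiv ℝ G z (kr₂ σ (k + 1) z) =
      η • kr₁ (k + 1) (G z) + μ • kr₂ τ (k + 1) (G z)) :
    resize (k + 1) k (fderiv ℝ G z (kr₂ σ (k + 1) z)) =
      μ • resize (k + 1) k (kr₂ τ (k + 1) (G z)) := by
  rw [h, map_add, map_smul, map_smul, kr₁_succ, resize_bv_of_le le_rfl, smul_zero, zero_add]

section Step

variable {A : E k →L[ℝ] E k} {z w : E (k + 1)} {ν η μ lam μ' : ℝ}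
  (h₁ : A (kr₁ k (resize (k + 1) k z)) =
    ν • kr₁ k (resize (k + 1) k w) + lam • kr₂ τ k (resize (k + 1) k w))
  (h₂ : A (kr₂ σ k (resize (k + 1) k z)) =
    η • kr₁ k (resize (k + 1) k w) + μ • kr₂ τ k (resize (k + 1) k w))
  (h₃ : A (resize (k + 1) k (kr₂ σ (k + 1) z)) = μ' • resize (k + 1) k (kr₂ τ (k + 1) w))

include h₁ h₂ h₃

/-- Here `A` stands for the differential of $\Phi^{(k)}$ and `w` for $\Phi^{(k+1)}(z)$. Keeping
`lam` lets one formula serve both the step from 3 to 4 and the later steps, where it vanishes. -/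
theorem step_regular (hk : 3 ≤ k) {c c' : ℝ} (hσ : σ (k + 1) = Prolongation.regular c)
    (hτ : τ (k + 1) = Prolongation.regular c') :
    (z (Fin.last k) + c) * ν + η = μ' * (w (Fin.last k) + c') ∧
      (z (Fin.last k) + c) * lam + μ = μ' := by
  rw [resize_kr₂_regular hk hσ, resize_kr₂_regular hk hτ, map_add, map_smul, h₁, h₂] at h₃
  refine kr_unique (σ := τ) hk (y := resize (k + 1) k w) (Eq.trans ?_ (h₃.trans ?_))
  · module
  · module

theorem step_singular (hk : 3 ≤ k) (hσ : σ (k + 1) = Prolongation.singular)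
    (hτ : τ (k + 1) = Prolongation.singular) :
    ν + z (Fin.last k) * η = μ' ∧ lam + z (Fin.last k) * μ = μ' * w (Fin.last k) := by
  rw [resize_kr₂_singular hk hσ, resize_kr₂_singular hk hτ, map_add, map_smul, h₁, h₂] at h₃
  refine kr_unique (σ := τ) hk (y := resize (k + 1) k w) (Eq.trans ?_ (h₃.trans ?_))
  · module
  · module

end Step

/-- Along a line in the direction of the last coordinate the base point is fixed, so the last
component is a Möbius function of one variable with constant coefficients. -/
theorem fderiv_last_kr₁_of_moebius {G : OpenPartialHomeomorph (E (k + 1)) (E (k + 1))}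
    {z : E (k + 1)} (hz : z ∈ G.source) (hG : DifferentiableAt ℝ G z) {n₀ n₁ d₀ d₁ : ℝ}
    (hd : d₀ + z (Fin.last k) * d₁ ≠ 0)
    (h : ∀ u ∈ G.source, resize (k + 1) k u = resize (k + 1) k z →
      G u (Fin.last k) = (n₀ + u (Fin.last k) * n₁) / (d₀ + u (Fin.last k) * d₁)) :
    fderiv ℝ (fun u => G u (Fin.last k)) z (kr₁ (k + 1) z) =
      (n₁ * d₀ - n₀ * d₁) / (d₀ + z (Fin.last k) * d₁) ^ 2 := by
  set t := z (Fin.last k) with ht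
  have hγ : HasDerivAt (fun s : ℝ => z + s • kr₁ (k + 1) z) (kr₁ (k + 1) z) 0 := by
    simpa using ((hasDerivAt_id (0 : ℝ)).smul_const (kr₁ (k + 1) z)).const_add z
  have hγ0 : z + (0 : ℝ) • kr₁ (k + 1) z = z := by simp
  have h1 : HasDerivAt (fun s : ℝ => G (z + s • kr₁ (k + 1) z) (Fin.last k))
      (fderiv ℝ (fun u => G u (Fin.last k)) z (kr₁ (k + 1) z)) 0 := by
    have hd' : DifferentiableAt ℝ (fun u => G u (Fin.last k)) (z + (0 : ℝ) • kr₁ (k + 1) z) := by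
      rw [hγ0]
      have : DifferentiableAt ℝ (fun u => co (k + 1) k (G u)) z :=
        (co (k + 1) k).differentiableAt.comp z hG
      simpa only [co_last] using this
    have := hd'.hasFDerivAt.comp_hasDerivAt (0 : ℝ) hγ
    rwa [hγ0] at this
  have h2 : HasDerivAt (fun s : ℝ => (n₀ + (t + s) * n₁) / (d₀ + (t + s) * d₁))
      ((n₁ * d₀ - n₀ * d₁) / (d₀ + t * d₁) ^ 2) 0 := by
    have ha : ∀ c₀ c₁ : ℝ, HasDerivAt (fun s : ℝ => c₀ + (t + s) * c₁) c₁ 0 := fun c₀ c₁ => by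
      simpa using (((hasDerivAt_id (0 : ℝ)).const_add t).mul_const c₁).const_add c₀
    have := (ha n₀ n₁).fun_div (ha d₀ d₁) (by simpa using hd)
    convert! this using 1
    rw [add_zero]
    ring
  refine h1.unique (h2.congr_of_eventuallyEq ?_)
  have hmem : ∀ᶠ s : ℝ in 𝓝 0, z + s • kr₁ (k + 1) z ∈ G.source :=
    hγ.continuousAt.eventually_mem (by rw [hγ0]; exact G.open_source.mem_nhds hz)
  filter_upwards [hmem] with s hs
  have e : (z + s • kr₁ (k + 1) z) (Fin.last k) = t + s := by simp [kr₁_last, ht]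
  rw [h _ hs (by rw [map_add, map_smul, kr₁_succ, resize_bv_of_le le_rfl, smul_zero, add_zero]), e]

end MultiplierLemmas

/-! ### Determination by the first three components -/

section Uniqueness

variable {σ τ τ' : ℕ → Prolongation} {n : ℕ}

theorem krField_congr {m : ℕ} (h : ∀ i, 4 ≤ i → i ≤ m + 3 → τ' i = τ i) (x : E n) :
    krField τ' n m x = krField τ n m x := by
  induction m with
  | zero => rfl
  | succ m ih =>
    have h1 := ih fun i hi him => h i hi (by omega)
    have h2 := h (m + 4) (by omega) (by omega)
    cases hs : τ (m + 4) with
    | regular c => rw [krField_regular hs, krField_regular (h2.trans hs), h1]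
    | singular => rw [krField_singular hs, krField_singular (h2.trans hs), h1]

theorem kr₂_congr {k : ℕ} (hk : 3 ≤ k) (h : ∀ i, 4 ≤ i → i ≤ k → τ' i = τ i) (y : E k) :
    kr₂ τ' k y = kr₂ τ k y := by
  obtain ⟨m, rfl⟩ := Nat.exists_eq_add_of_le' hk
  rw [kr₂_eq_krField, kr₂_eq_krField, krField_congr h]

/-- The index `k - 2` is that of the lift of $\kappa_2^{k+1}$. If `b` were zero its image would be
vertical over $\mathbb R^k$, and the inverse, which preserves vertical vectors, would make the field
itself vertical. -/
theorem PreservesFlag.exists_resize_fderiv {Φ : OpenPartialHomeomorph (E n) (E n)}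
    (h : PreservesFlag σ τ Φ) (h' : PreservesFlag τ σ Φ.symm) {k : ℕ} (hk : 3 ≤ k)
    (hkn : k + 1 ≤ n) {z : E n} (hz : z ∈ Φ.source) :
    ∃ b : ℝ, b ≠ 0 ∧ resize n k (fderiv ℝ Φ z (krField σ n (k - 2) z)) =
      b • resize (k + 1) k (kr₂ τ (k + 1) (resize n (k + 1) (Φ z))) := by
  obtain ⟨m, rfl⟩ := Nat.exists_eq_add_of_le' hk
  have e : m + 3 - 2 = m + 1 := by omega
  rw [e]
  set v := krField σ n (m + 1) z with hv
  obtain ⟨b, hb⟩ := mem_levelSub.1 (h.level (m + 1) (by omega) z hz v (krField_mem_levelSub z))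
  refine ⟨b, ?_, ?_⟩
  · rintro rfl
    have h1 : fderiv ℝ Φ z v ∈ Goursat.vert n (m + 3) := fun l hl => by rw [hb l hl, zero_mul]
    have h2 := h'.vert (m + 3) (by omega) (Φ z) (Φ.map_source hz) _ h1
    have hd : Φ.MDifferentiable (𝓡 n) (𝓡 n) :=
      ⟨(h.smooth.differentiableOn (by simp)).mdifferentiableOn,
        (h.smooth_symm.differentiableOn (by simp)).mdifferentiableOn⟩
    have h3 : fderiv ℝ Φ.symm (Φ z) (fderiv ℝ Φ z v) = v := by
      have := mfderiv_symm_mfderiv hd hz v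
      rw [mfderiv_eq_fderiv, mfderiv_eq_fderiv] at this
      exact this
    rw [h3] at h2
    obtain ⟨l, hl, hne⟩ := exists_co_krField_ne (σ := σ) (show m + 1 + 3 ≤ n by omega) z
    exact hne (h2 l hl)
  · have e1 : resize (m + 3 + 1) (m + 3)
        (kr₂ τ (m + 3 + 1) (resize n (m + 3 + 1) (Φ z))) =
        resize n (m + 3) (krField τ n (m + 1) (Φ z)) := by
      refine (congrArg (resize (m + 4) (m + 3)) (kr₂_eq_krField τ (m + 1) _)).trans ?_
      rw [← resize_krField (by omega) (by omega)]
      exact resize_resize (by omega) _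
    rw [e1, ← map_smul, resize_eq_resize_iff]
    intro l hl
    rw [hb l hl, map_smul, smul_eq_mul]

/-- Agreement of the first `k` components near a point forces agreement of their derivatives, so the
projections of the two fields $\tilde\kappa_2^{k+1}$ and $\kappa_2'^{k+1}$ are proportional. The
slope of this direction determines the next coordinate. -/
theorem contact_unique_step {Φ Φ' : OpenPartialHomeomorph (E n) (E n)}
    (h : PreservesFlag σ τ Φ) (hs : PreservesFlag τ σ Φ.symm)
    (h' : PreservesFlag σ τ' Φ') (hs' : PreservesFlag τ' σ Φ'.symm)
    (h0 : 0 ∈ Φ.source) (h0' : 0 ∈ Φ'.source) (hΦ : Φ 0 = 0) (hΦ' : Φ' 0 = 0)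
    {k : ℕ} (hk : 3 ≤ k) (hkn : k + 1 ≤ n) (hτ : ∀ i, 4 ≤ i → i ≤ k → τ' i = τ i)
    (hev : ∀ᶠ z in 𝓝 (0 : E n), resize n k (Φ' z) = resize n k (Φ z)) :
    τ' (k + 1) = τ (k + 1) ∧
      ∀ᶠ z in 𝓝 (0 : E n), resize n (k + 1) (Φ' z) = resize n (k + 1) (Φ z) := by
  have key : ∀ᶠ z in 𝓝 (0 : E n), resize n k (Φ' z) = resize n k (Φ z) ∧
      ∃ b b' : ℝ, b ≠ 0 ∧ b' ≠ 0 ∧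
        b • resize (k + 1) k (kr₂ τ (k + 1) (resize n (k + 1) (Φ z))) =
          b' • resize (k + 1) k (kr₂ τ' (k + 1) (resize n (k + 1) (Φ' z))) := by
    filter_upwards [hev.eventually_nhds, Φ.open_source.mem_nhds h0,
      Φ'.open_source.mem_nhds h0'] with z hz hzs hzs'
    obtain ⟨b, hb, hbe⟩ := h.exists_resize_fderiv hs hk hkn hzs
    obtain ⟨b', hb', hbe'⟩ := h'.exists_resize_fderiv hs' hk hkn hzs'
    refine ⟨hz.self_of_nhds, b, b', hb, hb', ?_⟩
    rw [← hbe, ← hbe']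
    have h1 : HasFDerivAt (fun x => resize n k (Φ x)) ((resize n k).comp (fderiv ℝ Φ z)) z :=
      (resize n k).hasFDerivAt.comp z (h.differentiableAt hzs).hasFDerivAt
    have h2 : HasFDerivAt (fun x => resize n k (Φ' x)) ((resize n k).comp (fderiv ℝ Φ' z)) z :=
      (resize n k).hasFDerivAt.comp z (h'.differentiableAt hzs').hasFDerivAt
    exact congrArg (fun L => L (krField σ n (k - 2) z)) (h1.unique (h2.congr_of_eventuallyEq
      (EventuallyEq.symm hz)))
  have hk1 : k ≤ k + 1 := Nat.le_succ k
  have hlast : ∀ x : E n, resize n (k + 1) x (Fin.last k) = co n k x := fun x => by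
    rw [← co_last, co_resize (Nat.lt_succ_self k)]
  obtain ⟨hz0, b, b', hb, hb', h00⟩ := key.self_of_nhds
  have hstep : ∀ z, resize n k (Φ' z) = resize n k (Φ z) → co n k (Φ' z) = co n k (Φ z) →
      resize n (k + 1) (Φ' z) = resize n (k + 1) (Φ z) := fun z h1 h2 => by
    rw [resize_eq_resize_iff] at h1 ⊢
    intro l hl
    rcases Nat.lt_succ_iff_lt_or_eq.1 hl with hl | rfl
    · exact h1 l hl
    · exact h2
  have hcong : ∀ y, kr₂ τ' k y = kr₂ τ k y := kr₂_congr hk hτ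
  cases hτk : τ (k + 1) with
  | regular c =>
    cases hτk' : τ' (k + 1) with
    | regular c' =>
      have comp : ∀ z, resize n k (Φ' z) = resize n k (Φ z) → ∀ b b' : ℝ,
          b • resize (k + 1) k (kr₂ τ (k + 1) (resize n (k + 1) (Φ z))) =
          b' • resize (k + 1) k (kr₂ τ' (k + 1) (resize n (k + 1) (Φ' z))) →
          b * (co n k (Φ z) + c) = b' * (co n k (Φ' z) + c') ∧ b = b' := by
        intro z hz b b' hbb
        rw [resize_kr₂_regular hk hτk, resize_kr₂_regular hk hτk', resize_resize hk1,
          resize_resize hk1, hlast, hlast, hcong, hz] at hbb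
        refine kr_unique (σ := τ) hk (y := resize n k (Φ z)) (Eq.trans ?_ (hbb.trans ?_))
        · module
        · module
      have h1 := comp 0 hz0 b b' h00
      -- Both maps fix the origin, where the slopes are the constants.
      have hc : c = c' := by
        have h2 := h1.1
        rw [hΦ, hΦ', h1.2, map_zero, zero_add, zero_add] at h2
        exact mul_left_cancel₀ hb' h2
      refine ⟨by rw [hc], ?_⟩
      filter_upwards [key] with z hz
      obtain ⟨hz, b, b', hb, hb', hbb⟩ := hz
      have h3 := comp z hz b b' hbb
      refine hstep z hz ?_
      have h4 := h3.1
      rw [h3.2, hc] at h4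
      have := mul_left_cancel₀ hb' h4
      linarith
    | singular =>
      -- At the origin a singular step projects to $\tilde\kappa_1^k$ alone, whereas a regular one
      -- has a nonzero $\tilde\kappa_2^k$-part.
      exfalso
      rw [resize_kr₂_regular hk hτk, resize_kr₂_singular hk hτk', resize_resize hk1,
        resize_resize hk1, hlast, hlast, hcong, hz0, hΦ, hΦ'] at h00
      have := kr_unique (σ := τ) hk (y := resize n k (0 : E n)) (a := b * c) (b := b) (a' := b')
        (b' := 0) (by simp only [map_zero] at h00 ⊢; refine Eq.trans ?_ (h00.trans ?_) <;> module)
      exact hb this.2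
  | singular =>
    cases hτk' : τ' (k + 1) with
    | regular c' =>
      exfalso
      rw [resize_kr₂_singular hk hτk, resize_kr₂_regular hk hτk', resize_resize hk1,
        resize_resize hk1, hlast, hlast, hcong, hz0, hΦ, hΦ'] at h00
      have := kr_unique (σ := τ) hk (y := resize n k (0 : E n)) (a := b) (b := 0) (a' := b' * c')
        (b' := b') (by simp only [map_zero] at h00 ⊢; refine Eq.trans ?_ (h00.trans ?_) <;> module)
      exact hb' this.2.symm
    | singular =>
      refine ⟨rfl, ?_⟩
      filter_upwards [key] with z hz
      obtain ⟨hz, b, b', hb, hb', hbb⟩ := hz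
      rw [resize_kr₂_singular hk hτk, resize_kr₂_singular hk hτk', resize_resize hk1,
        resize_resize hk1, hlast, hlast, hcong, hz] at hbb
      have h3 := kr_unique (σ := τ) hk (y := resize n k (Φ z)) (a := b) (b := b * co n k (Φ z))
        (a' := b') (b' := b' * co n k (Φ' z)) (by refine Eq.trans ?_ (hbb.trans ?_) <;> module)
      refine hstep z hz ?_
      have h4 := h3.2
      rw [h3.1] at h4
      exact (mul_left_cancel₀ hb' h4).symm

/-- A contact transformation between Kumpera-Ruiz normal forms that fixes the origin is determined
near the origin by its first three components, and so is the target normal form. -/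
theorem contact_unique (hn : 3 ≤ n) {Φ Φ' : OpenPartialHomeomorph (E n) (E n)}
    (h : IsContact (krDist σ n) (krDist τ n) Φ) (h' : IsContact (krDist σ n) (krDist τ' n) Φ')
    (h0 : 0 ∈ Φ.source) (h0' : 0 ∈ Φ'.source) (hΦ : Φ 0 = 0) (hΦ' : Φ' 0 = 0)
    (hev : ∀ᶠ z in 𝓝 (0 : E n), ∀ j : Fin n, (j : ℕ) < 3 → Φ' z j = Φ z j) :
    (∀ i, 4 ≤ i → i ≤ n → τ' i = τ i) ∧ ∀ᶠ z in 𝓝 (0 : E n), Φ' z = Φ z := by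
  have key : ∀ k, 3 ≤ k → k ≤ n → (∀ i, 4 ≤ i → i ≤ k → τ' i = τ i) ∧
      ∀ᶠ z in 𝓝 (0 : E n), resize n k (Φ' z) = resize n k (Φ z) := by
    intro k hk
    induction k, hk using Nat.le_induction with
    | base =>
      intro _
      refine ⟨fun i hi hi' => absurd hi (by omega), ?_⟩
      filter_upwards [hev] with z hz
      rw [resize_eq_resize_iff]
      intro k hk
      rw [co_apply (hk.trans_le hn), co_apply (hk.trans_le hn)]
      exact hz _ hk
    | succ k hk ih =>
      intro hkn
      obtain ⟨ih1, ih2⟩ := ih (by omega)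
      obtain ⟨h1, h2⟩ := contact_unique_step (h.preservesFlag hn) (h.symm.preservesFlag hn)
        (h'.preservesFlag hn) (h'.symm.preservesFlag hn) h0 h0' hΦ hΦ' hk hkn ih1 ih2
      refine ⟨fun i hi hik => ?_, h2⟩
      rcases Nat.le_succ_iff.1 hik with hik | rfl
      · exact ih1 i hi hik
      · exact h1
  obtain ⟨h1, h2⟩ := key n hn le_rfl
  refine ⟨h1, ?_⟩
  filter_upwards [h2] with z hz
  rwa [resize_self, resize_self] at hz

end Uniqueness

/-! ### From preservation of the flag back to contact transformations -/

section TowerMultipliers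

variable {σ τ : ℕ → Prolongation} {n : ℕ}

theorem finrank_span_kr (σ : ℕ → Prolongation) {k : ℕ} (hk : 3 ≤ k) (y : E k) :
    Module.finrank ℝ (Submodule.span ℝ ({kr₁ k y, kr₂ σ k y} : Set (E k))) = 2 := by
  have hli : LinearIndependent ℝ ![kr₁ k y, kr₂ σ k y] :=
    LinearIndependent.pair_iff.2 fun s t h => kr_unique (σ := σ) hk (y := y) (by simpa using h)
  have h := finrank_span_eq_card hli
  rwa [Matrix.range_cons, Matrix.range_cons, Matrix.range_empty, union_empty, singleton_union,
    Fintype.card_fin] at h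

theorem PreservesFlag.isContact {k : ℕ} (hk : 3 ≤ k) {F : OpenPartialHomeomorph (E k) (E k)}
    (h : PreservesFlag σ τ F) : IsContact (krDist σ k) (krDist τ k) F := by
  refine ⟨h.smooth.contMDiffOn, h.smooth_symm.contMDiffOn, fun y hy => ?_⟩
  have hinj := fderiv_injective h.smooth h.smooth_symm hy
  have hle : Submodule.map (fderiv ℝ F y).toLinearMap
      (Submodule.span ℝ ({kr₁ k y, kr₂ σ k y} : Set (E k))) ≤
      Submodule.span ℝ ({kr₁ k (F y), kr₂ τ k (F y)} : Set (E k)) := by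
    rintro _ ⟨u, hu, rfl⟩
    obtain ⟨a, b, rfl⟩ := Submodule.mem_span_pair.1 hu
    obtain ⟨a', b', h1⟩ := (mem_levelSub_iff_kr (by omega)).1 (h.level (k - 3) (by omega) y hy _
      ((mem_levelSub_iff_kr (by omega)).2 ⟨a, b, rfl⟩))
    exact Submodule.mem_span_pair.2 ⟨a', b', h1.symm⟩
  have heq := Submodule.eq_of_le_of_finrank_eq hle (by
    rw [finrank_span_kr τ hk]
    exact (Submodule.equivMapOfInjective _ hinj _).finrank_eq.symm.trans
      (finrank_span_kr σ hk y))
  rw [mfderiv_eq_fderiv]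
  exact heq

end TowerMultipliers

end Goursat

/-! ### The theorem -/

theorem mainTheorem7 {n : ℕ}
    {M : Type*} [TopologicalSpace M] [ChartedSpace (E n) M] [IsManifold (𝓡 n) ∞ M]
    {M' : Type*} [TopologicalSpace M'] [ChartedSpace (E n) M'] [IsManifold (𝓡 n) ∞ M']
    (D : Distribution n M) (hD : IsGoursat D)
    (D' : Distribution n M') (hD' : IsGoursat D')
    (p : M) (p' : M')
    (φ : OpenPartialHomeomorph M M') (hφ : IsContact D D' φ) (hp : p ∈ φ.source) (hpp' : φ p = p')
    -- the Kumpera-Ruiz normal forms, whose first prolongation is `R_0`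
    (σ τ : ℕ → Prolongation)
    (hσ : 4 ≤ n → σ 4 = Prolongation.regular 0) (hτ : 4 ≤ n → τ 4 = Prolongation.regular 0)
    (x : OpenPartialHomeomorph M (E n)) (hx : IsKRChart D p σ x)
    (x' : OpenPartialHomeomorph M' (E n)) (hx' : IsKRChart D' p' τ x')
    -- `Φ = x' ∘ φ ∘ x⁻¹`
    (Φ : OpenPartialHomeomorph (E n) (E n)) (hΦ : Φ = (x.symm.trans φ).trans x') :
    singularityType D p = singularityType D' p' ∧
    -- on arbitrarily small neighborhoods of zero the diffeomorphisms `Φ⁽ⁱ⁾` are well defined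
    (∀ V ∈ 𝓝 (0 : E n), ∃ W : Set (E n), IsOpen W ∧ 0 ∈ W ∧ W ⊆ V ∧ W ⊆ Φ.source ∧
      ∃ Φs : ∀ i, OpenPartialHomeomorph (E i) (E i), IsTower Φ W Φs) ∧
    (∀ W : Set (E n), IsOpen W → 0 ∈ W → W ⊆ Φ.source →
      ∀ Φs : ∀ i, OpenPartialHomeomorph (E i) (E i), IsTower Φ W Φs →
      IsContact (krDist σ 3) (krDist τ 3) (Φs 3) ∧
      ∃ (ν η μ : ∀ i, E i → ℝ) (lam : E 3 → ℝ),
        FirstMultipliers σ τ (Φs 3) (ν 3) (η 3) (μ 3) lam ∧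
        (∀ ν₃ η₃ μ₃ lam₃ : E 3 → ℝ, FirstMultipliers σ τ (Φs 3) ν₃ η₃ μ₃ lam₃ →
          EqOn ν₃ (ν 3) (Φs 3).source ∧ EqOn η₃ (η 3) (Φs 3).source ∧
          EqOn μ₃ (μ 3) (Φs 3).source ∧ EqOn lam₃ lam (Φs 3).source) ∧
        (∀ i, 4 ≤ i → i ≤ n → Multipliers σ τ i (Φs i) (ν i) (η i) (μ i) ∧
          ∀ νᵢ ηᵢ μᵢ : E i → ℝ, Multipliers σ τ i (Φs i) νᵢ ηᵢ μᵢ →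
            EqOn νᵢ (ν i) (Φs i).source ∧ EqOn ηᵢ (η i) (Φs i).source ∧
            EqOn μᵢ (μ i) (Φs i).source) ∧
        -- the component `Φ_4`; here `y = (z_1, z_2, z_3)` and `t = z_4`
        (4 ≤ n → ∀ z ∈ (Φs 4).source, ∀ (y : E 3) (t : ℝ),
          y = proj (Nat.le_succ 3) z → t = z (Fin.last 3) →
          μ 3 y + t * lam y ≠ 0 ∧
          Φs 4 z (Fin.last 3) = (η 3 y + t * ν 3 y) / (μ 3 y + t * lam y) ∧
          μ 4 z = μ 3 y + t * lam y ∧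
          ν 4 z = fderiv ℝ (fun u => Φs 4 u (Fin.last 3)) z (kr₁ 4 z) ∧
          ν 4 z = (μ 3 y * ν 3 y - lam y * η 3 y) / (μ 3 y + t * lam y) ^ 2 ∧
          η 4 z = fderiv ℝ (fun u => Φs 4 u (Fin.last 3)) z (kr₂ σ 4 z)) ∧
        -- the component `Φ_i`, `i = k + 1 ≥ 5`, when `w_{i-4} ≠ a_1`
        (∀ k, 4 ≤ k → k + 1 ≤ n → (singularityType D p)[k + 1 - 4]? ≠ some 1 →
          ∃ c c' : ℝ, σ (k + 1) = Prolongation.regular c ∧ τ (k + 1) = Prolongation.regular c' ∧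
            c' = c * (ν k 0 / μ k 0) + η k 0 / μ k 0 ∧
            ∀ z ∈ (Φs (k + 1)).source, ∀ (y : E k) (t : ℝ),
              y = proj (Nat.le_succ k) z → t = z (Fin.last k) →
              μ k y ≠ 0 ∧
              Φs (k + 1) z (Fin.last k) = 1 / μ k y * ((t + c) * ν k y + η k y) - c' ∧
              μ (k + 1) z = μ k y ∧
              ν (k + 1) z = fderiv ℝ (fun u => Φs (k + 1) u (Fin.last k)) z (kr₁ (k + 1) z) ∧
              ν (k + 1) z = ν k y / μ k y ∧
              η (k + 1) z = fderiv ℝ (fun u => Φs (k + 1) u (Fin.last k)) z (kr₂ σ (k + 1) z)) ∧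
        -- the component `Φ_i`, `i = k + 1 ≥ 5`, when `w_{i-4} = a_1`
        (∀ k, 4 ≤ k → k + 1 ≤ n → (singularityType D p)[k + 1 - 4]? = some 1 →
          σ (k + 1) = Prolongation.singular ∧ τ (k + 1) = Prolongation.singular ∧
            ∀ z ∈ (Φs (k + 1)).source, ∀ (y : E k) (t : ℝ),
              y = proj (Nat.le_succ k) z → t = z (Fin.last k) →
              ν k y + t * η k y ≠ 0 ∧
              Φs (k + 1) z (Fin.last k) = t * μ k y / (ν k y + t * η k y) ∧
              μ (k + 1) z = ν k y + t * η k y ∧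
              ν (k + 1) z = fderiv ℝ (fun u => Φs (k + 1) u (Fin.last k)) z (kr₁ (k + 1) z) ∧
              ν (k + 1) z = μ k y * ν k y / (ν k y + t * η k y) ^ 2 ∧
              η (k + 1) z =
                fderiv ℝ (fun u => Φs (k + 1) u (Fin.last k)) z (kr₂ σ (k + 1) z))) ∧
    -- `Φ`, and with it `κ̃ⁿ`, is determined by `κⁿ` and `Φ⁽³⁾`
    (∀ τ' : ℕ → Prolongation, (4 ≤ n → τ' 4 = Prolongation.regular 0) →
      ∀ Φ' : OpenPartialHomeomorph (E n) (E n), IsContact (krDist σ n) (krDist τ' n) Φ' →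
        0 ∈ Φ'.source → Φ' 0 = 0 →
        (∀ᶠ z in 𝓝 (0 : E n), ∀ j : Fin n, (j : ℕ) < 3 → Φ' z j = Φ z j) →
        (∀ i, 4 ≤ i → i ≤ n → τ' i = τ i) ∧ ∀ᶠ z in 𝓝 (0 : E n), Φ' z = Φ z) := by
  have hn : 3 ≤ n := hD.three_le
  have hc : IsContact (krDist σ n) (krDist τ n) Φ := by
    rw [hΦ]
    exact (hx.isContact.symm.trans hφ).trans hx'.isContact
  have hx0 : x.symm 0 = p := by rw [← hx.centered, x.left_inv hx.mem_source]
  have h0 : (0 : E n) ∈ Φ.source := by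
    rw [hΦ, OpenPartialHomeomorph.trans_source, OpenPartialHomeomorph.trans_source]
    refine ⟨⟨?_, ?_⟩, ?_⟩
    · exact hx.centered ▸ x.map_source hx.mem_source
    · rw [mem_preimage, hx0]
      exact hp
    · rw [mem_preimage, OpenPartialHomeomorph.coe_trans, Function.comp_apply, hx0, hpp']
      exact hx'.mem_source
  have hΦ0 : Φ 0 = 0 := by
    rw [hΦ, OpenPartialHomeomorph.coe_trans, OpenPartialHomeomorph.coe_trans, Function.comp_apply,
      Function.comp_apply, hx0, hpp', hx'.centered]
  have hflag := hc.preservesFlag hn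
  have hδ : singularityType D p = singularityType D' p' := hpp' ▸ hφ.singularityType_eq hp
  have hδσ : singularityType D p = singularityType (krDist σ n) 0 :=
    hx.centered ▸ hx.isContact.singularityType_eq hx.mem_source
  have hδτ : singularityType D p = singularityType (krDist τ n) 0 :=
    hδ.trans (hx'.centered ▸ hx'.isContact.singularityType_eq hx'.mem_source)
  refine ⟨hδ, fun V hV => hflag.exists_tower (hc.symm.preservesFlag hn) h0 hΦ0 hV, ?_,
    fun τ' _ Φ' hΦ' h0' hΦ'0 hev => contact_unique hn hc hΦ' h0 h0' hΦ0 hΦ'0 hev⟩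
  intro W hW h0W hWs Φs hT
  have hpf : ∀ i, 3 ≤ i → i ≤ n → PreservesFlag σ τ (Φs i) := fun i hi hin =>
    hT.preservesFlag hW hWs hflag hi hin
  -- Outside `3 ≤ i ≤ n` the multipliers get the dummy value zero. A function `lam` is kept for
  -- every `i`, so that the recursion has one form.
  have hex : ∀ i, ∃ ν η μ lam : E i → ℝ, 3 ≤ i → i ≤ n →
      ContDiffOn ℝ ∞ ν (Φs i).source ∧ ContDiffOn ℝ ∞ η (Φs i).source ∧
      ContDiffOn ℝ ∞ μ (Φs i).source ∧ ContDiffOn ℝ ∞ lam (Φs i).source ∧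
      (∀ y ∈ (Φs i).source, fderiv ℝ (Φs i) y (kr₁ i y) =
        ν y • kr₁ i (Φs i y) + lam y • kr₂ τ i (Φs i y)) ∧
      (∀ y ∈ (Φs i).source, fderiv ℝ (Φs i) y (kr₂ σ i y) =
        η y • kr₁ i (Φs i y) + μ y • kr₂ τ i (Φs i y)) ∧
      (4 ≤ i → ∀ y ∈ (Φs i).source, lam y = 0) := by
    intro i
    by_cases hi : 3 ≤ i ∧ i ≤ n
    · obtain ⟨ν, η, μ, lam, h⟩ := (hpf i hi.1 hi.2).exists_multipliers hi.1
      exact ⟨ν, η, μ, lam, fun _ _ => h⟩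
    · exact ⟨0, 0, 0, 0, fun h1 h2 => absurd ⟨h1, h2⟩ hi⟩
  choose ν η μ lam hmul using hex
  have hF : FirstMultipliers σ τ (Φs 3) (ν 3) (η 3) (μ 3) (lam 3) := by
    obtain ⟨h1, h2, h3, h4, h5, h6, -⟩ := hmul 3 le_rfl hn
    exact ⟨h1, h2, h3, h4, h5, h6⟩
  have hM : ∀ i, 4 ≤ i → i ≤ n → Multipliers σ τ i (Φs i) (ν i) (η i) (μ i) := by
    intro i hi hin
    obtain ⟨h1, h2, h3, -, h5, h6, h7⟩ := hmul i (by omega) hin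
    exact ⟨h1, h2, h3, fun y hy => by rw [h5 y hy, h7 hi y hy, zero_smul, add_zero], h6⟩
  -- All denominators are nonzero for this reason: they are $\mu_{k+1}$ in the step to 4 and in
  -- singular steps, and $\mu_k$ in regular ones.
  have hμ : ∀ i, 4 ≤ i → i ≤ n → ∀ y ∈ (Φs i).source, μ i y ≠ 0 := fun i hi hin y hy =>
    multipliers_ne_zero (by omega)
      (fderiv_injective (hT.smooth i (by omega) hin) (hT.smooth_symm i (by omega) hin) hy)
      ((hM i hi hin).push₁ y hy) ((hM i hi hin).push₂ y hy)
  have hzero : ∀ i, 3 ≤ i → i ≤ n → (0 : E i) ∈ (Φs i).source ∧ Φs i 0 = 0 := by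
    intro i hi hin
    have h1 := hT.resize_mem hi hin h0W
    have h2 := hT.apply_resize hi hin h0W
    rw [map_zero] at h1
    rw [hΦ0, map_zero] at h2
    exact ⟨h1, h2⟩
  -- the equations for the `k + 1`-st component
  have hreg : ∀ k, 3 ≤ k → k + 1 ≤ n → ∀ c c' : ℝ, σ (k + 1) = Prolongation.regular c →
      τ (k + 1) = Prolongation.regular c' → ∀ z ∈ (Φs (k + 1)).source,
      (z (Fin.last k) + c) * ν k (resize (k + 1) k z) + η k (resize (k + 1) k z) =
        μ (k + 1) z * (Φs (k + 1) z (Fin.last k) + c') ∧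
      (z (Fin.last k) + c) * lam k (resize (k + 1) k z) + μ k (resize (k + 1) k z) =
        μ (k + 1) z := by
    intro k hk hkn c c' hσk hτk z hz
    obtain ⟨h1, h2, h3⟩ := hT.succ hW hWs hflag hk hkn hz
    obtain ⟨-, -, -, -, h5, h6, -⟩ := hmul k hk (by omega)
    refine step_regular (h2 ▸ h5 _ h1) (h2 ▸ h6 _ h1) ?_ hk hσk hτk
    rw [h3, resize_push₂ ((hM (k + 1) (by omega) hkn).push₂ z hz)]
  have hsing : ∀ k, 3 ≤ k → k + 1 ≤ n → σ (k + 1) = Prolongation.singular →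
      τ (k + 1) = Prolongation.singular → ∀ z ∈ (Φs (k + 1)).source,
      ν k (resize (k + 1) k z) + z (Fin.last k) * η k (resize (k + 1) k z) = μ (k + 1) z ∧
      lam k (resize (k + 1) k z) + z (Fin.last k) * μ k (resize (k + 1) k z) =
        μ (k + 1) z * Φs (k + 1) z (Fin.last k) := by
    intro k hk hkn hσk hτk z hz
    obtain ⟨h1, h2, h3⟩ := hT.succ hW hWs hflag hk hkn hz
    obtain ⟨-, -, -, -, h5, h6, -⟩ := hmul k hk (by omega)
    refine step_singular (h2 ▸ h5 _ h1) (h2 ▸ h6 _ h1) ?_ hk hσk hτk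
    rw [h3, resize_push₂ ((hM (k + 1) (by omega) hkn).push₂ z hz)]
  have hlast : ∀ k, 3 ≤ k → k + 1 ≤ n → ∀ z ∈ (Φs (k + 1)).source,
      ν (k + 1) z = fderiv ℝ (fun u => Φs (k + 1) u (Fin.last k)) z (kr₁ (k + 1) z) ∧
      η (k + 1) z = fderiv ℝ (fun u => Φs (k + 1) u (Fin.last k)) z (kr₂ σ (k + 1) z) :=
    fun k hk hkn z hz => (hM (k + 1) (by omega) hkn).last_eq (by omega) hz
      (hT.differentiableAt (by omega) hkn hz)
  have hmoeb : ∀ k, 3 ≤ k → k + 1 ≤ n → ∀ z ∈ (Φs (k + 1)).source, ∀ n₀ n₁ d₀ d₁ : ℝ,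
      d₀ + z (Fin.last k) * d₁ ≠ 0 →
      (∀ u ∈ (Φs (k + 1)).source, resize (k + 1) k u = resize (k + 1) k z →
        Φs (k + 1) u (Fin.last k) =
          (n₀ + u (Fin.last k) * n₁) / (d₀ + u (Fin.last k) * d₁)) →
      ν (k + 1) z = (n₁ * d₀ - n₀ * d₁) / (d₀ + z (Fin.last k) * d₁) ^ 2 :=
    fun k hk hkn z hz n₀ n₁ d₀ d₁ hd h => (hlast k hk hkn z hz).1.trans
      (fderiv_last_kr₁_of_moebius hz (hT.differentiableAt (by omega) hkn hz) hd h)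
  refine ⟨(hpf 3 le_rfl hn).isContact le_rfl, ν, η, μ, lam 3, hF,
    fun _ _ _ _ h => hF.unique h,
    fun i hi hin => ⟨hM i hi hin, fun _ _ _ h => (hM i hi hin).unique (by omega) h⟩, ?_, ?_, ?_⟩
  · intro h4 z hz y t hy ht
    rw [proj_eq_resize] at hy
    subst hy ht
    have heq := hreg 3 le_rfl h4 0 0 (hσ h4) (hτ h4)
    simp only [add_zero] at heq
    have hden : ∀ u ∈ (Φs 4).source, μ 3 (resize 4 3 u) +
        u (Fin.last 3) * lam 3 (resize 4 3 u) = μ 4 u := fun u hu => by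
      rw [← (heq u hu).2, add_comm]
    have hne : ∀ u ∈ (Φs 4).source, μ 3 (resize 4 3 u) +
        u (Fin.last 3) * lam 3 (resize 4 3 u) ≠ 0 := fun u hu => by
      rw [hden u hu]
      exact hμ 4 le_rfl h4 u hu
    have hcomp : ∀ u ∈ (Φs 4).source, Φs 4 u (Fin.last 3) =
        (η 3 (resize 4 3 u) + u (Fin.last 3) * ν 3 (resize 4 3 u)) /
          (μ 3 (resize 4 3 u) + u (Fin.last 3) * lam 3 (resize 4 3 u)) := fun u hu => by
      rw [eq_div_iff (hne u hu), hden u hu, mul_comm, ← (heq u hu).1, add_comm]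
    refine ⟨hne z hz, hcomp z hz, (hden z hz).symm, (hlast 3 le_rfl h4 z hz).1, ?_,
      (hlast 3 le_rfl h4 z hz).2⟩
    rw [hmoeb 3 le_rfl h4 z hz _ _ _ _ (hne z hz) fun u hu hu' => hu' ▸ hcomp u hu]
    ring
  · intro k hk hkn hw
    have hσk := (not_congr (singularityType_krDist_iff (σ := σ) hk hkn)).1 (hδσ ▸ hw)
    have hτk := (not_congr (singularityType_krDist_iff (σ := τ) hk hkn)).1 (hδτ ▸ hw)
    obtain ⟨c, hc⟩ : ∃ c, σ (k + 1) = Prolongation.regular c := by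
      cases h : σ (k + 1) with
      | regular c => exact ⟨c, rfl⟩
      | singular => exact absurd h hσk
    obtain ⟨c', hc'⟩ : ∃ c, τ (k + 1) = Prolongation.regular c := by
      cases h : τ (k + 1) with
      | regular c => exact ⟨c, rfl⟩
      | singular => exact absurd h hτk
    have hlam : ∀ z ∈ (Φs (k + 1)).source, lam k (resize (k + 1) k z) = 0 := fun z hz =>
      (hmul k (by omega) (by omega)).2.2.2.2.2.2 hk _
        (hT.succ hW hWs hflag (by omega) hkn hz).1
    have hne : ∀ z ∈ (Φs (k + 1)).source, μ k (resize (k + 1) k z) ≠ 0 := fun z hz =>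
      hμ k hk (by omega) _ (hT.succ hW hWs hflag (by omega) hkn hz).1
    have hμk : ∀ z ∈ (Φs (k + 1)).source, μ (k + 1) z = μ k (resize (k + 1) k z) := fun z hz => by
      rw [← (hreg k (by omega) hkn c c' hc hc' z hz).2, hlam z hz, mul_zero, zero_add]
    have heq : ∀ z ∈ (Φs (k + 1)).source,
        (z (Fin.last k) + c) * ν k (resize (k + 1) k z) + η k (resize (k + 1) k z) =
          μ k (resize (k + 1) k z) * (Φs (k + 1) z (Fin.last k) + c') := fun z hz => by
      rw [← hμk z hz]
      exact (hreg k (by omega) hkn c c' hc hc' z hz).1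
    refine ⟨c, c', hc, hc', ?_, ?_⟩
    · obtain ⟨h1, h2⟩ := hzero (k + 1) (by omega) hkn
      -- As $\Phi^{(k+1)}$ fixes the origin, the equation there contains only the constants and the
      -- multipliers.
      have h3 := heq 0 h1
      have h4 := hne 0 h1
      rw [h2] at h3
      rw [map_zero] at h3 h4
      simp only [PiLp.zero_apply, zero_add] at h3
      field_simp
      linarith
    · intro z hz y t hy ht
      rw [proj_eq_resize] at hy
      subst hy ht
      have hnez := hne z hz
      refine ⟨hnez, ?_, hμk z hz, (hlast k (by omega) hkn z hz).1, ?_,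
        (hlast k (by omega) hkn z hz).2⟩
      · rw [heq z hz]
        field_simp
        ring
      -- A regular step is the affine case of a Möbius function, with constant denominator $\mu_k$
      -- and $-\tilde c_{k+1}$ absorbed into the numerator.
      · rw [hmoeb k (by omega) hkn z hz
          (c * ν k (resize (k + 1) k z) + η k (resize (k + 1) k z) -
            c' * μ k (resize (k + 1) k z)) (ν k (resize (k + 1) k z))
          (μ k (resize (k + 1) k z)) 0 (by simpa using hnez) fun u hu hu' => ?_]
        · rw [mul_zero, sub_zero, mul_zero, add_zero]
          field_simp
        · have h1 := heq u hu
          rw [hu'] at h1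
          rw [mul_zero, add_zero, eq_div_iff hnez]
          linarith
  · intro k hk hkn hw
    have hσk := (singularityType_krDist_iff (σ := σ) hk hkn).1 (hδσ ▸ hw)
    have hτk := (singularityType_krDist_iff (σ := τ) hk hkn).1 (hδτ ▸ hw)
    refine ⟨hσk, hτk, fun z hz y t hy ht => ?_⟩
    rw [proj_eq_resize] at hy
    subst hy ht
    have heq := hsing k (by omega) hkn hσk hτk
    have hlam : ∀ z ∈ (Φs (k + 1)).source, lam k (resize (k + 1) k z) = 0 := fun z hz =>
      (hmul k (by omega) (by omega)).2.2.2.2.2.2 hk _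
        (hT.succ hW hWs hflag (by omega) hkn hz).1
    have hne : ∀ u ∈ (Φs (k + 1)).source, ν k (resize (k + 1) k u) +
        u (Fin.last k) * η k (resize (k + 1) k u) ≠ 0 := fun u hu => by
      rw [(heq u hu).1]
      exact hμ (k + 1) (by omega) hkn u hu
    have hcomp : ∀ u ∈ (Φs (k + 1)).source, Φs (k + 1) u (Fin.last k) =
        u (Fin.last k) * μ k (resize (k + 1) k u) / (ν k (resize (k + 1) k u) +
          u (Fin.last k) * η k (resize (k + 1) k u)) := fun u hu => by
      rw [eq_div_iff (hne u hu), (heq u hu).1, mul_comm, ← (heq u hu).2, hlam u hu, zero_add]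
    refine ⟨hne z hz, hcomp z hz, (heq z hz).1.symm, (hlast k (by omega) hkn z hz).1, ?_,
      (hlast k (by omega) hkn z hz).2⟩
    rw [hmoeb k (by omega) hkn z hz 0 _ _ _ (hne z hz) fun u hu hu' => by
      rw [zero_add]
      exact hu' ▸ hcomp u hu]
    ring
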